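/- Let $H$ be a (finite-dimensional) semisimple Hopf algebra over $\mathbb{C}$, and let $H^*$ be its dual Hopf algebra, with product $(fg)(a)=\sum f(a_{(1)})g(a_{(2)})$ and coproduct $\Delta(f)(a\otimes b)=f(ab)$. For a finite-dimensional semisimple Hopf algebra $K$ over $\mathbb{C}$, let $\operatorname{Rep}(K)$ be the rigid monoidal category of finite-dimensional left $K$-modules, where $\mathbf 1$ is the trivial module and $X^*$ denotes the left dual of $X$, with action $(hf)(x)=f(S(h)x)$. A pivotal structure on $\operatorname{Rep}(K)$ is a monoidal natural isomorphism $j_X\colon X\to X^{**}$; it is called canonical if the pivotal trace $\operatorname{ev}_{X^*}\circ(j_X\otimes\operatorname{id}_{X^*})\circ\operatorname{coev}_X\in\operatorname{End}(\mathbf 1)=\mathbb{C}$ of $\operatorname{id}_X$ equals $\dim_{\mathbb C}X$ (the Frobenius–Perron dimension of $X$) for every $X$. For $X\in\operatorname{Rep}(K)$ and $n\ge 1$, the $n$-th Frobenius–Schur indicator of $X$ is the trace $\nu_n(X)=\operatorname{Tr}\big(E_X^{(n)}\big)$ of the linear endomorphism $$E_X^{(n)}\colon \operatorname{Hom}_K(\mathbf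 1,X^{\otimes n})\to \operatorname{Hom}_K(\mathbf 1,X^{\otimes n}),\qquad f\mapsto(\operatorname{ev}_X\otimes\operatorname{id}_{X}^{\otimes(n-1)}\otimes j_X^{-1})\circ(\operatorname{id}_{X^*}\otimes f\otimes\operatorname{id}_{X^{**}})\circ\operatorname{coev}_{X^*},$$ formed with the canonical pivotal structure $j$ of $\operatorname{Rep}(K)$ (associativity and unit constraints are suppressed). Then $H^*$ is semisimple, each of $\operatorname{Rep}(H)$ and $\operatorname{Rep}(H^*)$ has exactly one canonical pivotal structure, and the indicators of the regular representations (left multiplication) of $H^*$ and $H$ coincide: $$\nu_n(H^*)=\nu_n(H)\qquad\text{for all } n\ge 1 .$$ -/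

import Mathlib

open TensorProduct

universe u

set_option linter.unusedSectionVars false

namespace HopfFS

noncomputable section

/-! ### The dual Hopf algebra of a finite-dimensional Hopf algebra -/

section DualHopf

variable (k : Type*) (H : Type u) [Field k] [Ring H] [HopfAlgebra k H]

/-- The linear dual `H^*`, with Mathlib's convolution product (`WithConv`)
`(f * g)(h) = ∑ f(h₁) g(h₂)`, whose unit is the counit of `H`, as multiplication. -/
def HopfDual : Type _ := WithConv (H →ₗ[k] k)

instance : Ring (HopfDual k H) := inferInstanceAs (Ring (WithConv (H →ₗ[k] k)))

instance : Algebra k (HopfDual k H) := inferInstanceAs (Algebra k (WithConv (H →ₗ[k] k)))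

/-- The elements of `H^*` are the linear forms on `H`. -/
def toForm : HopfDual k H ≃ₗ[k] Module.Dual k H where
  toFun f := WithConv.ofConv f
  invFun f := WithConv.toConv f
  map_add' _ _ := rfl
  map_smul' _ _ := rfl
  left_inv _ := rfl
  right_inv _ := rfl

theorem toForm_mul (f g : HopfDual k H) (a : H) :
    toForm k H (f * g) a = LinearMap.mul' k k
      (TensorProduct.map (toForm k H f) (toForm k H g) (Coalgebra.comul a)) := rfl

theorem toForm_one (a : H) : toForm k H 1 a = Coalgebra.counit a := rfl

/-- The pairing `H^* ⊗ H^* → (H ⊗ H)^*`, `(f ⊗ g)(a ⊗ b) = f(a) g(b)`. -/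
def pair₂ : HopfDual k H ⊗[k] HopfDual k H →ₗ[k] Module.Dual k (H ⊗[k] H) :=
  TensorProduct.dualDistrib k H H ∘ₗ
    TensorProduct.map (toForm k H).toLinearMap
      (toForm k H).toLinearMap

@[simp] theorem pair₂_tmul (f g : HopfDual k H) (a b : H) :
    pair₂ k H (f ⊗ₜ g) (a ⊗ₜ b) = toForm k H f a * toForm k H g b := by
  simp [pair₂]

variable [FiniteDimensional k H]

/-- `pair₂` is an isomorphism in finite dimension. -/
def pairEquiv : HopfDual k H ⊗[k] HopfDual k H ≃ₗ[k] Module.Dual k (H ⊗[k] H) :=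
  (TensorProduct.congr (toForm k H)
    (toForm k H)).trans (TensorProduct.dualDistribEquiv k H H)

theorem pairEquiv_apply (x : HopfDual k H ⊗[k] HopfDual k H) :
    pairEquiv k H x = pair₂ k H x := by
  induction x with
  | zero => simp
  | add x y hx hy => simp only [map_add, hx, hy]
  | tmul f g => rfl

theorem pair₂_injective : Function.Injective (pair₂ k H) := by
  intro x y h
  apply (pairEquiv k H).injective
  simpa [pairEquiv_apply] using h

/-- The comultiplication of `H^*`: `Δ(f)(a ⊗ b) = f(a b)`. -/
def dualComul : HopfDual k H →ₗ[k] HopfDual k H ⊗[k] HopfDual k H :=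
  (pairEquiv k H).symm.toLinearMap ∘ₗ (LinearMap.mul' k H).dualMap ∘ₗ
    (toForm k H).toLinearMap

@[simp] theorem pair₂_dualComul (f : HopfDual k H) (a b : H) :
    pair₂ k H (dualComul k H f) (a ⊗ₜ b) = toForm k H f (a * b) := by
  rw [← pairEquiv_apply]
  simp [dualComul]

/-- The counit of `H^*`: evaluation at `1`. -/
def dualCounit : HopfDual k H →ₗ[k] k :=
  LinearMap.applyₗ (1 : H) ∘ₗ (toForm k H).toLinearMap

@[simp] theorem dualCounit_apply (f : HopfDual k H) : dualCounit k H f = toForm k H f 1 := rfl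

/-- The antipode of `H^*`: the transpose of the antipode of `H`. -/
def dualAntipode : HopfDual k H →ₗ[k] HopfDual k H :=
  (toForm k H).symm.toLinearMap ∘ₗ
    (HopfAlgebra.antipode k (A := H)).dualMap ∘ₗ
    (toForm k H).toLinearMap

@[simp] theorem dualAntipode_apply (f : HopfDual k H) (a : H) :
    toForm k H (dualAntipode k H f) a = toForm k H f (HopfAlgebra.antipode k a) := rfl

/-- The pairing of `H^* ⊗ (H^* ⊗ H^*)` with three elements of `H`. -/
def pair₃ (a b c : H) : HopfDual k H ⊗[k] (HopfDual k H ⊗[k] HopfDual k H) →ₗ[k] k :=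
  LinearMap.mul' k k ∘ₗ TensorProduct.map
    (LinearMap.applyₗ a ∘ₗ (toForm k H).toLinearMap)
    (LinearMap.applyₗ (b ⊗ₜ[k] c) ∘ₗ pair₂ k H)

@[simp] theorem pair₃_tmul (a b c : H) (f : HopfDual k H)
    (x : HopfDual k H ⊗[k] HopfDual k H) :
    pair₃ k H a b c (f ⊗ₜ x) = toForm k H f a * pair₂ k H x (b ⊗ₜ c) := by
  simp [pair₃]

theorem pair₃_ext {x y : HopfDual k H ⊗[k] (HopfDual k H ⊗[k] HopfDual k H)}
    (h : ∀ a b c, pair₃ k H a b c x = pair₃ k H a b c y) : x = y := by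
  let e := (TensorProduct.congr (toForm k H) (pairEquiv k H)).trans
    (TensorProduct.dualDistribEquiv k H (H ⊗[k] H))
  have he : ∀ z a b c, e z (a ⊗ₜ[k] (b ⊗ₜ[k] c)) = pair₃ k H a b c z := by
    intro z a b c
    induction z with
    | zero => simp
    | add z w hz hw => simp only [map_add, LinearMap.add_apply, hz, hw]
    | tmul f w =>
      rw [pair₃_tmul, ← pairEquiv_apply]
      rfl
  apply e.injective
  ext a b c
  simp [he, h]

theorem pair₃_lTensor (a b c : H) (x : HopfDual k H ⊗[k] HopfDual k H) :
    pair₃ k H a b c ((dualComul k H).lTensor (HopfDual k H) x) =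
      pair₂ k H x (a ⊗ₜ (b * c)) := by
  induction x with
  | zero => simp
  | add x y hx hy => simp only [map_add, LinearMap.add_apply, hx, hy]
  | tmul f g => simp

theorem pair₃_assoc_tmul (a b c : H) (x : HopfDual k H ⊗[k] HopfDual k H) (g : HopfDual k H) :
    pair₃ k H a b c (TensorProduct.assoc k _ _ _ (x ⊗ₜ g)) =
      pair₂ k H x (a ⊗ₜ b) * toForm k H g c := by
  induction x with
  | zero => simp
  | add x y hx hy => simp only [map_add, LinearMap.add_apply, TensorProduct.add_tmul, hx, hy,
      add_mul]
  | tmul f g' => simp [mul_assoc]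

theorem pair₃_rTensor (a b c : H) (x : HopfDual k H ⊗[k] HopfDual k H) :
    pair₃ k H a b c (TensorProduct.assoc k _ _ _
      ((dualComul k H).rTensor (HopfDual k H) x)) = pair₂ k H x ((a * b) ⊗ₜ c) := by
  induction x with
  | zero => simp
  | add x y hx hy => simp only [map_add, LinearMap.add_apply, hx, hy]
  | tmul f g => rw [LinearMap.rTensor_tmul, pair₃_assoc_tmul]; simp

theorem rTensor_dualCounit (x : HopfDual k H ⊗[k] HopfDual k H) (a : H) :
    toForm k H (TensorProduct.lid k _ ((dualCounit k H).rTensor (HopfDual k H) x)) a =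
      pair₂ k H x (1 ⊗ₜ a) := by
  induction x with
  | zero => simp
  | add x y hx hy => simp only [map_add, LinearMap.add_apply, hx, hy]
  | tmul f g => simp

theorem lTensor_dualCounit (x : HopfDual k H ⊗[k] HopfDual k H) (a : H) :
    toForm k H (TensorProduct.rid k _ ((dualCounit k H).lTensor (HopfDual k H) x)) a =
      pair₂ k H x (a ⊗ₜ 1) := by
  induction x with
  | zero => simp
  | add x y hx hy => simp only [map_add, LinearMap.add_apply, hx, hy]
  | tmul f g => simp [mul_comm]

theorem pair₂_mul (x y : HopfDual k H ⊗[k] HopfDual k H) (t : H ⊗[k] H) :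
    pair₂ k H (x * y) t = LinearMap.mul' k k
      (TensorProduct.map (pair₂ k H x) (pair₂ k H y) (Coalgebra.comul t)) := by
  induction x with
  | zero => rw [zero_mul]; simp
  | add x x' hx hx' =>
    rw [add_mul]; simp only [map_add, LinearMap.add_apply, hx, hx', TensorProduct.map_add_left]
  | tmul f g =>
    induction y with
    | zero => rw [mul_zero]; simp
    | add y y' hy hy' =>
      rw [mul_add]; simp only [map_add, LinearMap.add_apply, hy, hy', TensorProduct.map_add_right]
    | tmul f' g' =>
      induction t with
      | zero => simp
      | add t t' ht ht' => simp only [map_add, ht, ht']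
      | tmul a b =>
        rw [Algebra.TensorProduct.tmul_mul_tmul, pair₂_tmul, toForm_mul, toForm_mul,
          TensorProduct.comul_tmul, ← (Coalgebra.Repr.arbitrary k a).eq,
          ← (Coalgebra.Repr.arbitrary k b).eq]
        simp only [TensorProduct.sum_tmul, TensorProduct.tmul_sum, map_sum, Finset.sum_mul,
          Finset.mul_sum, TensorProduct.map_tmul, LinearMap.mul'_apply,
          TensorProduct.AlgebraTensorModule.tensorTensorTensorComm_tmul, pair₂_tmul]
        exact Finset.sum_congr rfl fun i _ => Finset.sum_congr rfl fun j _ => by ring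

theorem dualComul_one : dualComul k H 1 = 1 := by
  apply pair₂_injective
  ext a b
  simp [Algebra.TensorProduct.one_def, toForm_one]

theorem dualComul_mul (f g : HopfDual k H) :
    dualComul k H (f * g) = dualComul k H f * dualComul k H g := by
  apply pair₂_injective
  ext a b
  simp only [TensorProduct.AlgebraTensorModule.curry_apply, TensorProduct.curry_apply,
    LinearMap.coe_restrictScalars]
  rw [pair₂_dualComul, toForm_mul, pair₂_mul, Bialgebra.comul_mul, TensorProduct.comul_tmul,
    ← (Coalgebra.Repr.arbitrary k a).eq, ← (Coalgebra.Repr.arbitrary k b).eq]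
  simp only [TensorProduct.sum_tmul, TensorProduct.tmul_sum, map_sum, Finset.sum_mul,
    Finset.mul_sum, TensorProduct.map_tmul, LinearMap.mul'_apply,
    Algebra.TensorProduct.tmul_mul_tmul,
    TensorProduct.AlgebraTensorModule.tensorTensorTensorComm_tmul, pair₂_dualComul]

instance : Coalgebra k (HopfDual k H) where
  comul := dualComul k H
  counit := dualCounit k H
  coassoc := by
    ext f
    apply pair₃_ext
    intro a b c
    simp [pair₃_rTensor, pair₃_lTensor, mul_assoc]
  rTensor_counit_comp_comul := by
    ext f
    apply (TensorProduct.lid k _).injective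
    apply (toForm k H).injective
    ext a
    simp [rTensor_dualCounit]
  lTensor_counit_comp_comul := by
    ext f
    apply (TensorProduct.rid k _).injective
    apply (toForm k H).injective
    ext a
    simp [lTensor_dualCounit]

instance : Bialgebra k (HopfDual k H) :=
  Bialgebra.mk' k (HopfDual k H)
    (by change toForm k H 1 1 = 1; simp [toForm_one])
    (fun {f g} => by
      change toForm k H (f * g) 1 = toForm k H f 1 * toForm k H g 1
      simp [toForm_mul, Algebra.TensorProduct.one_def])
    (dualComul_one k H) (fun {f g} => dualComul_mul k H f g)

theorem pair₂_dualComul_apply (f : HopfDual k H) (t : H ⊗[k] H) :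
    pair₂ k H (dualComul k H f) t = toForm k H f (LinearMap.mul' k H t) := by
  induction t with
  | zero => simp
  | add t t' ht ht' => simp only [map_add, ht, ht']
  | tmul a b => simp

theorem toForm_mul'_rTensor (x : HopfDual k H ⊗[k] HopfDual k H) (a : H) :
    toForm k H (LinearMap.mul' k _ ((dualAntipode k H).rTensor _ x)) a =
      pair₂ k H x ((HopfAlgebra.antipode k).rTensor H (Coalgebra.comul a)) := by
  induction x with
  | zero => simp
  | add x y hx hy => simp only [map_add, LinearMap.add_apply, hx, hy]
  | tmul f g =>
    rw [LinearMap.rTensor_tmul, LinearMap.mul'_apply, toForm_mul,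
      ← (Coalgebra.Repr.arbitrary k a).eq]
    simp

theorem toForm_mul'_lTensor (x : HopfDual k H ⊗[k] HopfDual k H) (a : H) :
    toForm k H (LinearMap.mul' k _ ((dualAntipode k H).lTensor _ x)) a =
      pair₂ k H x ((HopfAlgebra.antipode k).lTensor H (Coalgebra.comul a)) := by
  induction x with
  | zero => simp
  | add x y hx hy => simp only [map_add, LinearMap.add_apply, hx, hy]
  | tmul f g =>
    rw [LinearMap.lTensor_tmul, LinearMap.mul'_apply, toForm_mul,
      ← (Coalgebra.Repr.arbitrary k a).eq]
    simp

/-- The dual Hopf algebra. -/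
instance : HopfAlgebra k (HopfDual k H) where
  antipode := dualAntipode k H
  mul_antipode_rTensor_comul := by
    ext f
    apply (toForm k H).injective
    ext a
    change toForm k H (LinearMap.mul' k _ ((dualAntipode k H).rTensor _ (dualComul k H f))) a =
      toForm k H (algebraMap k (HopfDual k H) (toForm k H f 1)) a
    rw [toForm_mul'_rTensor, pair₂_dualComul_apply,
      HopfAlgebra.mul_antipode_rTensor_comul_apply, Algebra.algebraMap_eq_smul_one,
      Algebra.algebraMap_eq_smul_one, map_smul, map_smul, LinearMap.smul_apply, toForm_one,
      smul_eq_mul, smul_eq_mul, mul_comm]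
  mul_antipode_lTensor_comul := by
    ext f
    apply (toForm k H).injective
    ext a
    change toForm k H (LinearMap.mul' k _ ((dualAntipode k H).lTensor _ (dualComul k H f))) a =
      toForm k H (algebraMap k (HopfDual k H) (toForm k H f 1)) a
    rw [toForm_mul'_lTensor, pair₂_dualComul_apply,
      HopfAlgebra.mul_antipode_lTensor_comul_apply, Algebra.algebraMap_eq_smul_one,
      Algebra.algebraMap_eq_smul_one, map_smul, map_smul, LinearMap.smul_apply, toForm_one,
      smul_eq_mul, smul_eq_mul, mul_comm]

instance : FiniteDimensional k (HopfDual k H) :=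
  Module.Finite.equiv (toForm k H).symm

end DualHopf

/-! ### Actions of a Hopf algebra on vector spaces -/

section Actions

variable {k : Type*} {H : Type*} [Field k] [Ring H] [HopfAlgebra k H]
variable {V W U V' W' : Type*} [AddCommGroup V] [Module k V] [AddCommGroup W] [Module k W]
  [AddCommGroup U] [Module k U] [AddCommGroup V'] [Module k V'] [AddCommGroup W'] [Module k W']

/-- The action on a tensor product, `h (v ⊗ w) = ∑ h₁ v ⊗ h₂ w`. -/
def tensorAction (ρ : H →ₐ[k] Module.End k V) (σ : H →ₐ[k] Module.End k W) :
    H →ₐ[k] Module.End k (V ⊗[k] W) :=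
  ((Module.endTensorEndAlgHom (R := k) (S := k) (A := k) (M := V) (N := W)).comp
    (Algebra.TensorProduct.map ρ σ)).comp (Bialgebra.comulAlgHom k H)

/-- The action on the dual space, `(h f)(v) = f(S(h) v)`. -/
def dualAction (ρ : H →ₐ[k] Module.End k V) : H →ₐ[k] Module.End k (Module.Dual k V) :=
  AlgHom.ofLinearMap
    (Module.Dual.transpose (R := k) ∘ₗ ρ.toLinearMap ∘ₗ HopfAlgebra.antipode k)
    (by ext f v; simp [Module.Dual.transpose_apply])
    (by intro a b; ext f v
        simp [Module.Dual.transpose_apply, HopfAlgebra.antipode_mul_antidistrib])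

variable (k H) in
/-- The trivial action: `h` acts as multiplication by `ε(h)`. -/
def trivialAction (V : Type*) [AddCommGroup V] [Module k V] : H →ₐ[k] Module.End k V :=
  (Algebra.ofId k (Module.End k V)).comp (Bialgebra.counitAlgHom k H)

theorem tensorAction_tmul (ρ : H →ₐ[k] Module.End k V) (σ : H →ₐ[k] Module.End k W)
    {ι : Type*} {h : H} (r : Coalgebra.Repr k h ι) (v : V) (w : W) :
    tensorAction ρ σ h (v ⊗ₜ w) = ∑ i ∈ r.index, ρ (r.left i) v ⊗ₜ σ (r.right i) w := by
  simp [tensorAction, ← r.eq, Module.endTensorEndAlgHom_apply]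

@[simp] theorem dualAction_apply (ρ : H →ₐ[k] Module.End k V) (h : H) (f : Module.Dual k V)
    (v : V) : dualAction ρ h f v = f (ρ (HopfAlgebra.antipode k h) v) := rfl

@[simp] theorem trivialAction_apply (h : H) (v : V) :
    trivialAction k H V h v = Coalgebra.counit (R := k) h • v := rfl

/-- `H`-linearity of a linear map between two representations. -/
def Equivariant (ρ : H →ₐ[k] Module.End k V) (σ : H →ₐ[k] Module.End k W) (f : V →ₗ[k] W) :
    Prop := ∀ h v, f (ρ h v) = σ h (f v)

variable {ρ : H →ₐ[k] Module.End k V} {σ : H →ₐ[k] Module.End k W}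
  {τ : H →ₐ[k] Module.End k U} {ρ' : H →ₐ[k] Module.End k V'} {σ' : H →ₐ[k] Module.End k W'}

theorem Equivariant.comp {g : W →ₗ[k] U} {f : V →ₗ[k] W} (hg : Equivariant σ τ g)
    (hf : Equivariant ρ σ f) : Equivariant ρ τ (g ∘ₗ f) := fun h v => by
  rw [LinearMap.comp_apply, LinearMap.comp_apply, hf, hg]

theorem Equivariant.symm {e : V ≃ₗ[k] W} (he : Equivariant ρ σ e.toLinearMap) :
    Equivariant σ ρ e.symm.toLinearMap := fun h w => by
  apply e.injective
  have := he h (e.symm w)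
  simp only [LinearEquiv.coe_coe, LinearEquiv.apply_symm_apply] at this ⊢
  rw [this]

theorem Equivariant.tensor {f : V →ₗ[k] V'} {g : W →ₗ[k] W'} (hf : Equivariant ρ ρ' f)
    (hg : Equivariant σ σ' g) :
    Equivariant (tensorAction ρ σ) (tensorAction ρ' σ') (TensorProduct.map f g) := fun h t => by
  induction t with
  | zero => simp
  | add t t' ht ht' => simp only [map_add, ht, ht']
  | tmul v w =>
    rw [tensorAction_tmul ρ σ (Coalgebra.Repr.arbitrary k h), TensorProduct.map_tmul,
      tensorAction_tmul ρ' σ' (Coalgebra.Repr.arbitrary k h), map_sum]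
    exact Finset.sum_congr rfl fun i _ => by rw [TensorProduct.map_tmul, hf, hg]

theorem Equivariant.dualMap {f : V →ₗ[k] W} (hf : Equivariant ρ σ f) :
    Equivariant (dualAction σ) (dualAction ρ) f.dualMap := fun h φ => by
  ext v
  simp [hf _ v]

theorem equivariant_assoc (ρ : H →ₐ[k] Module.End k V) (σ : H →ₐ[k] Module.End k W)
    (τ : H →ₐ[k] Module.End k U) :
    Equivariant (tensorAction (tensorAction ρ σ) τ) (tensorAction ρ (tensorAction σ τ))
      (TensorProduct.assoc k V W U).toLinearMap := fun h t => by
  induction t with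
  | zero => simp
  | add t t' ht ht' => simp only [map_add, ht, ht']
  | tmul s u =>
    induction s with
    | zero => simp
    | add s s' hs hs' => simp only [TensorProduct.add_tmul, map_add, hs, hs']
    | tmul v w =>
      let Φ : H ⊗[k] (H ⊗[k] H) →ₗ[k] V ⊗[k] (W ⊗[k] U) :=
        TensorProduct.map (ρ.toLinearMap.flip v)
          (TensorProduct.map (σ.toLinearMap.flip w) (τ.toLinearMap.flip u))
      have h1 : ∀ x : H ⊗[k] H, ∀ c : H,
          Φ (TensorProduct.assoc k H H H (x ⊗ₜ c)) = TensorProduct.assoc k V W U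
            (TensorProduct.map (ρ.toLinearMap.flip v) (σ.toLinearMap.flip w) x ⊗ₜ τ c u) := by
        intro x c
        induction x with
        | zero => simp
        | add x x' hx hx' => simp only [TensorProduct.add_tmul, map_add, hx, hx']
        | tmul a b => simp [Φ]
      have key := congrArg Φ (Coalgebra.coassoc_apply (R := k) h)
      rw [← (Coalgebra.Repr.arbitrary k h).eq] at key
      simp only [map_sum, LinearMap.rTensor_tmul, LinearMap.lTensor_tmul, h1] at key
      rw [tensorAction_tmul _ τ (Coalgebra.Repr.arbitrary k h)]
      simp only [LinearEquiv.coe_coe, map_sum, TensorProduct.assoc_tmul]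
      rw [tensorAction_tmul ρ _ (Coalgebra.Repr.arbitrary k h)]
      convert key using 2 with i _ i _
      · congr 2
        rw [tensorAction_tmul ρ σ (Coalgebra.Repr.arbitrary k _),
          ← (Coalgebra.Repr.arbitrary k ((Coalgebra.Repr.arbitrary k h).left i)).eq]
        simp
      · rw [tensorAction_tmul σ τ (Coalgebra.Repr.arbitrary k _),
          ← (Coalgebra.Repr.arbitrary k ((Coalgebra.Repr.arbitrary k h).right i)).eq]
        simp [Φ]

theorem sum_counit_smul (σ : H →ₐ[k] Module.End k W) {ι : Type*} {h : H}
    (r : Coalgebra.Repr k h ι) (w : W) :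
    ∑ i ∈ r.index, Coalgebra.counit (R := k) (r.left i) • σ (r.right i) w = σ h w := by
  conv_rhs => rw [← Coalgebra.sum_counit_smul r]
  simp

theorem sum_smul_counit (σ : H →ₐ[k] Module.End k W) {ι : Type*} {h : H}
    (r : Coalgebra.Repr k h ι) (w : W) :
    ∑ i ∈ r.index, Coalgebra.counit (R := k) (r.right i) • σ (r.left i) w = σ h w := by
  have := congrArg (TensorProduct.lift ((LinearMap.lsmul k W).flip ∘ₗ σ.toLinearMap.flip w))
    (Coalgebra.sum_tmul_counit_eq r)
  simpa only [map_sum, TensorProduct.lift.tmul, LinearMap.comp_apply, LinearMap.flip_apply,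
    LinearMap.lsmul_apply, AlgHom.toLinearMap_apply, one_smul] using this

/-- The left unit isomorphism `𝟙 ⊗ W ≅ W`, where the field is lifted to another universe. -/
def lunit (k : Type) (W : Type*) [Field k] [AddCommGroup W] [Module k W] :
    ULift.{u} k ⊗[k] W ≃ₗ[k] W :=
  (TensorProduct.congr ULift.moduleEquiv (LinearEquiv.refl k W)).trans (TensorProduct.lid k W)

/-- The right unit isomorphism `W ⊗ 𝟙 ≅ W`, where the field is lifted to another universe. -/
def runit (k : Type) (W : Type*) [Field k] [AddCommGroup W] [Module k W] :
    W ⊗[k] ULift.{u} k ≃ₗ[k] W :=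
  (TensorProduct.congr (LinearEquiv.refl k W) ULift.moduleEquiv).trans (TensorProduct.rid k W)

/-- The evaluation `V^* ⊗ V → 𝟙`, `f ⊗ v ↦ f(v)`. -/
def evMap (k : Type) (V : Type*) [Field k] [AddCommGroup V] [Module k V] :
    Module.Dual k V ⊗[k] V →ₗ[k] ULift.{u} k :=
  ULift.moduleEquiv.symm.toLinearMap ∘ₗ contractLeft k V

/-- The coevaluation `𝟙 → V ⊗ V^*`, `1 ↦ ∑ eᵢ ⊗ eⁱ`. -/
def coevMap (k : Type) (V : Type*) [Field k] [AddCommGroup V] [Module k V]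
    [FiniteDimensional k V] : ULift.{u} k →ₗ[k] V ⊗[k] Module.Dual k V :=
  coevaluation k V ∘ₗ ULift.moduleEquiv.toLinearMap

end Actions

section UnitActions

variable {k : Type} {H : Type*} [Field k] [Ring H] [HopfAlgebra k H]
variable {V W : Type*} [AddCommGroup V] [Module k V] [AddCommGroup W] [Module k W]

theorem equivariant_lunit (σ : H →ₐ[k] Module.End k W) :
    Equivariant (tensorAction (trivialAction k H (ULift.{u} k)) σ) σ
      (lunit.{u} k W).toLinearMap := fun h t => by
  induction t with
  | zero => simp
  | add t t' ht ht' => simp only [map_add, ht, ht']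
  | tmul c w =>
    rw [tensorAction_tmul _ σ (Coalgebra.Repr.arbitrary k h), map_sum,
      ← sum_counit_smul σ (Coalgebra.Repr.arbitrary k h)]
    refine Finset.sum_congr rfl fun i _ => ?_
    simp [lunit, mul_smul]

theorem equivariant_runit (σ : H →ₐ[k] Module.End k W) :
    Equivariant (tensorAction σ (trivialAction k H (ULift.{u} k))) σ
      (runit.{u} k W).toLinearMap := fun h t => by
  induction t with
  | zero => simp
  | add t t' ht ht' => simp only [map_add, ht, ht']
  | tmul w c =>
    rw [tensorAction_tmul σ _ (Coalgebra.Repr.arbitrary k h), map_sum,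
      ← sum_smul_counit σ (Coalgebra.Repr.arbitrary k h)]
    refine Finset.sum_congr rfl fun i _ => ?_
    simp [runit]

theorem equivariant_ev (ρ : H →ₐ[k] Module.End k V) :
    Equivariant (tensorAction (dualAction ρ) ρ) (trivialAction k H (ULift.{u} k))
      (evMap.{u} k V) := fun h t => by
  induction t with
  | zero => simp
  | add t t' ht ht' => simp only [map_add, ht, ht']
  | tmul f v =>
    rw [tensorAction_tmul _ ρ (Coalgebra.Repr.arbitrary k h), map_sum]
    apply (ULift.moduleEquiv (R := k) (M := k)).injective
    have := congrArg (fun a : H => f (ρ a v))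
      (HopfAlgebra.sum_antipode_mul_eq_smul (R := k) (Coalgebra.Repr.arbitrary k h))
    simpa [evMap] using this

theorem equivariant_coev [FiniteDimensional k V] (ρ : H →ₐ[k] Module.End k V) :
    Equivariant (trivialAction k H (ULift.{u} k)) (tensorAction ρ (dualAction ρ))
      (coevMap.{u} k V) := fun h c => by
  have key : tensorAction ρ (dualAction ρ) h (coevaluation k V 1) =
      Coalgebra.counit (R := k) h • coevaluation k V 1 := by
    -- compare the two elements of `V ⊗ V^*` as endomorphisms of `V`
    let Ψ : V ⊗[k] Module.Dual k V ≃ₗ[k] (V →ₗ[k] V) :=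
      (TensorProduct.comm k V (Module.Dual k V)).trans (dualTensorHomEquiv k V V)
    have hΨ : ∀ v f w, Ψ (v ⊗ₜ f) w = f w • v := fun v f w => by simp [Ψ]
    have h1 : Ψ (coevaluation k V 1) = LinearMap.id := by
      rw [coevaluation_apply_one]
      ext w
      simp only [map_sum, LinearMap.sum_apply, hΨ, LinearMap.id_apply]
      exact (Module.Basis.ofVectorSpace k V).sum_repr w
    have h2 : ∀ (a b : H) (t : V ⊗[k] Module.Dual k V),
        Ψ (TensorProduct.map (ρ a) (dualAction ρ b) t) =
          ρ a ∘ₗ Ψ t ∘ₗ ρ (HopfAlgebra.antipode k b) := by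
      intro a b t
      induction t with
      | zero => simp
      | add t t' ht ht' =>
        simp only [map_add, ht, ht', LinearMap.add_comp, LinearMap.comp_add]
      | tmul v f => ext w; simp [hΨ]
    have h3 : ∀ t, tensorAction ρ (dualAction ρ) h t =
        ∑ i ∈ (Coalgebra.Repr.arbitrary k h).index,
          TensorProduct.map (ρ ((Coalgebra.Repr.arbitrary k h).left i))
            (dualAction ρ ((Coalgebra.Repr.arbitrary k h).right i)) t := by
      intro t
      induction t with
      | zero => simp
      | add t t' ht ht' => simp only [map_add, ht, ht', Finset.sum_add_distrib]
      | tmul v f => rw [tensorAction_tmul _ _ (Coalgebra.Repr.arbitrary k h)]; simp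
    apply Ψ.injective
    rw [h3, map_sum, map_smul, h1]
    simp only [h2, h1]
    ext w
    have := congrArg (fun a : H => ρ a w)
      (HopfAlgebra.sum_mul_antipode_eq_smul (R := k) (Coalgebra.Repr.arbitrary k h))
    simpa using this
  obtain ⟨c, rfl⟩ := (ULift.moduleEquiv (R := k) (M := k)).symm.surjective c
  have hc : ∀ d : k, coevaluation k V d = d • coevaluation k V 1 := fun d => by
    rw [← map_smul, smul_eq_mul, mul_one]
  simp only [coevMap, trivialAction_apply, LinearMap.comp_apply, map_smul,
    LinearEquiv.coe_coe, LinearEquiv.apply_symm_apply]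
  rw [hc c, map_smul, key, smul_comm]

end UnitActions

/-! ### The rigid monoidal category of finite-dimensional representations -/

/-- A finite-dimensional representation (left module) of the Hopf algebra `H` over `k`. -/
structure HopfRep (k : Type) (H : Type u) [Field k] [Ring H] [HopfAlgebra k H] where
  /-- The underlying vector space. -/
  V : Type u
  [addCommGroup : AddCommGroup V]
  [module : Module k V]
  [finite : FiniteDimensional k V]
  /-- The action. -/
  ρ : H →ₐ[k] Module.End k V

attribute [instance] HopfRep.addCommGroup HopfRep.module HopfRep.finite

namespace HopfRep

variable {k : Type} {H : Type u} [Field k] [Ring H] [HopfAlgebra k H]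

variable (k H) in
/-- The regular representation: `H` acting on itself by left multiplication. -/
def regular [FiniteDimensional k H] : HopfRep k H where
  V := H
  ρ := Algebra.lmul k H

variable (k H) in
/-- The unit object: (a copy, in the universe of `H`, of) the field, with `h` acting as `ε(h)`. -/
abbrev unit : HopfRep k H where
  V := ULift.{u} k
  ρ := trivialAction k H (ULift.{u} k)

/-- The tensor product of two representations. -/
abbrev tensor (X Y : HopfRep k H) : HopfRep k H where
  V := X.V ⊗[k] Y.V
  ρ := tensorAction X.ρ Y.ρ

/-- The left dual `X^*` of a representation. -/
abbrev dual (X : HopfRep k H) : HopfRep k H where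
  V := Module.Dual k X.V
  ρ := dualAction X.ρ

/-- Morphisms of representations: the space of `H`-linear maps. -/
def Hom (X Y : HopfRep k H) : Submodule k (X.V →ₗ[k] Y.V) where
  carrier := {f | Equivariant X.ρ Y.ρ f}
  add_mem' hf hg h v := by simp [hf h v, hg h v]
  zero_mem' h v := by simp
  smul_mem' c f hf h v := by simp [hf h v]

/-- The tensor power `X^{⊗ n}`: `X^{⊗ 0} = 𝟙` and `X^{⊗ (n+1)} = X ⊗ X^{⊗ n}`. -/
def tpow (X : HopfRep k H) : ℕ → HopfRep k H
  | 0 => unit k H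
  | n + 1 => X.tensor (X.tpow n)

namespace Hom

variable {X Y Z W : HopfRep k H}

/-- The identity morphism. -/
def id (X : HopfRep k H) : Hom X X := ⟨LinearMap.id, fun _ _ => rfl⟩

/-- The composite `g ∘ f`. -/
def comp (g : Hom Y Z) (f : Hom X Y) : Hom X Z := ⟨g.1 ∘ₗ f.1, Equivariant.comp g.2 f.2⟩

/-- The tensor product of two morphisms. -/
def tensor (f : Hom X Y) (g : Hom Z W) : Hom (X.tensor Z) (Y.tensor W) :=
  ⟨TensorProduct.map f.1 g.1, Equivariant.tensor f.2 g.2⟩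

/-- The dual (transpose) of a morphism. -/
def dual (f : Hom X Y) : Hom Y.dual X.dual := ⟨f.1.dualMap, Equivariant.dualMap f.2⟩

/-- The evaluation `X^* ⊗ X → 𝟙`. -/
def ev (X : HopfRep k H) : Hom (X.dual.tensor X) (unit k H) :=
  ⟨evMap k X.V, equivariant_ev X.ρ⟩

/-- The coevaluation `𝟙 → X ⊗ X^*`. -/
def coev (X : HopfRep k H) : Hom (unit k H) (X.tensor X.dual) :=
  ⟨coevMap k X.V, equivariant_coev X.ρ⟩

end Hom

end HopfRep

local infixr:80 " ⊚ " => HopfRep.Hom.comp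
local infixr:90 " ⊗ₕ " => HopfRep.Hom.tensor

namespace HopfRep

variable {k : Type} {H : Type u} [Field k] [Ring H] [HopfAlgebra k H]

/-- Isomorphisms of representations. -/
structure Iso (X Y : HopfRep k H) where
  /-- The underlying linear isomorphism. -/
  toEquiv : X.V ≃ₗ[k] Y.V
  equivariant : Equivariant X.ρ Y.ρ toEquiv.toLinearMap

namespace Iso

variable {X Y Z W : HopfRep k H}

/-- The isomorphism as a morphism. -/
def hom (e : Iso X Y) : Hom X Y := ⟨e.toEquiv.toLinearMap, e.equivariant⟩

/-- The inverse isomorphism as a morphism. -/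
def inv (e : Iso X Y) : Hom Y X := ⟨e.toEquiv.symm.toLinearMap, e.equivariant.symm⟩

/-- The associativity constraint `(X ⊗ Y) ⊗ Z ≅ X ⊗ (Y ⊗ Z)`. -/
def assoc (X Y Z : HopfRep k H) : Iso ((X.tensor Y).tensor Z) (X.tensor (Y.tensor Z)) :=
  ⟨TensorProduct.assoc k X.V Y.V Z.V, equivariant_assoc X.ρ Y.ρ Z.ρ⟩

/-- The left unit constraint `𝟙 ⊗ X ≅ X`. -/
def leftUnit (X : HopfRep k H) : Iso ((unit k H).tensor X) X :=
  ⟨lunit k X.V, equivariant_lunit X.ρ⟩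

/-- The right unit constraint `X ⊗ 𝟙 ≅ X`. -/
def rightUnit (X : HopfRep k H) : Iso (X.tensor (unit k H)) X :=
  ⟨runit k X.V, equivariant_runit X.ρ⟩

end Iso

/-- The coherence isomorphism `X^{⊗ n} ⊗ X → X ⊗ X^{⊗ n} = X^{⊗ (n+1)}`, built from the
associativity and unit constraints: `(x₁ ⊗ ⋯ ⊗ xₙ) ⊗ x ↦ x₁ ⊗ ⋯ ⊗ xₙ ⊗ x`. -/
def snoc (X : HopfRep k H) : ∀ n, Hom ((X.tpow n).tensor X) (X.tensor (X.tpow n))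
  | 0 => (Iso.rightUnit X).inv ⊚ (Iso.leftUnit X).hom
  | n + 1 => (Hom.id X ⊗ₕ X.snoc n) ⊚ (Iso.assoc X (X.tpow n) X).hom

end HopfRep

/-! ### Pivotal structures and Frobenius–Schur indicators -/

open HopfRep

variable {k : Type} {H : Type u} [Field k] [Ring H] [HopfAlgebra k H]

/-- A pivotal structure on the category of finite-dimensional representations of `H`:
a monoidal natural isomorphism `j : X ≅ X^{**}`. -/
@[ext] structure PivotalStructure (k : Type) (H : Type u) [Field k] [Ring H]
    [HopfAlgebra k H] where
  /-- The components. -/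
  j : ∀ X : HopfRep k H, Iso X X.dual.dual
  natural : ∀ {X Y : HopfRep k H} (f : Hom X Y),
    (j Y).hom ⊚ f = Hom.dual (Hom.dual f) ⊚ (j X).hom
  /-- Compatibility with the tensor product: `j_{X ⊗ Y}` is `j_X ⊗ j_Y` under the canonical
  isomorphism `X^{**} ⊗ Y^{**} ≅ (X ⊗ Y)^{**}`.  The functionals `f ⊗ g` span `(X ⊗ Y)^*`,
  so that it suffices to test on them. -/
  monoidal : ∀ (X Y : HopfRep k H) (x : X.V) (y : Y.V)
    (f : Module.Dual k X.V) (g : Module.Dual k Y.V),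
    (j (X.tensor Y)).toEquiv (x ⊗ₜ y) (TensorProduct.dualDistrib k X.V Y.V (f ⊗ₜ g)) =
      (j X).toEquiv x f * (j Y).toEquiv y g
  /-- Compatibility with the unit object. -/
  monoidal_unit : ∀ (c : (unit k H).V) (f : Module.Dual k (unit k H).V),
    (j (unit k H)).toEquiv c f = f c

/-- The categorical trace of `f : X → X^{**}`: the scalar `ev_{X^*} ∘ (f ⊗ id) ∘ coev_X`
in `End(𝟙) = k`. -/
def catTrace {X : HopfRep k H} (f : Hom X X.dual.dual) : k :=
  ((Hom.ev X.dual ⊚ (f ⊗ₕ Hom.id X.dual) ⊚ Hom.coev X).1 (ULift.up 1)).down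

namespace PivotalStructure

/-- The pivotal trace of an endomorphism. -/
def ptr (P : PivotalStructure k H) {X : HopfRep k H} (g : Hom X X) : k :=
  catTrace ((P.j X).hom ⊚ g)

/-- A pivotal structure is canonical if the pivotal dimension of each object is its
Frobenius–Perron dimension, which for a representation is its dimension as a vector space. -/
def IsCanonical (P : PivotalStructure k H) : Prop :=
  ∀ X : HopfRep k H, P.ptr (Hom.id X) = (Module.finrank k X.V : k)

/-- For `n = m + 1` (so that `X^{⊗ n} = X ⊗ X^{⊗ m}`), the value on `f : 𝟙 → X^{⊗ n}` of the map `E_X^{(n)}`, i.e.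
`(ev_X ⊗ id_X^{⊗ (n-1)} ⊗ j_X⁻¹) ∘ (id_{X^*} ⊗ f ⊗ id_{X^{**}}) ∘ coev_{X^*}`,
with the associativity and unit constraints written out. -/
def EFun (P : PivotalStructure k H) (X : HopfRep k H) (m : ℕ)
    (f : Hom (unit k H) (X.tensor (X.tpow m))) : Hom (unit k H) (X.tensor (X.tpow m)) :=
  -- `𝟙 → X^* ⊗ X^{**} → X^* ⊗ (𝟙 ⊗ X^{**})`
  let s₁ : Hom (unit k H) (X.dual.tensor ((unit k H).tensor X.dual.dual)) :=
    (Hom.id X.dual ⊗ₕ (Iso.leftUnit X.dual.dual).inv) ⊚ Hom.coev X.dual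
  -- `X^* ⊗ (𝟙 ⊗ X^{**}) → X^* ⊗ ((X ⊗ X^{⊗ m}) ⊗ X^{**})`
  let s₂ : Hom (X.dual.tensor ((unit k H).tensor X.dual.dual))
      (X.dual.tensor ((X.tensor (X.tpow m)).tensor X.dual.dual)) :=
    Hom.id X.dual ⊗ₕ f ⊗ₕ Hom.id X.dual.dual
  -- `X^* ⊗ ((X ⊗ X^{⊗ m}) ⊗ X^{**}) → (X^* ⊗ X) ⊗ (X^{⊗ m} ⊗ X^{**})`
  let s₃ : Hom (X.dual.tensor ((X.tensor (X.tpow m)).tensor X.dual.dual))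
      ((X.dual.tensor X).tensor ((X.tpow m).tensor X.dual.dual)) :=
    (Iso.assoc X.dual X ((X.tpow m).tensor X.dual.dual)).inv ⊚
      (Hom.id X.dual ⊗ₕ (Iso.assoc X (X.tpow m) X.dual.dual).hom)
  -- `(X^* ⊗ X) ⊗ (X^{⊗ m} ⊗ X^{**}) → 𝟙 ⊗ (X^{⊗ m} ⊗ X) → X^{⊗ m} ⊗ X → X^{⊗ (m+1)}`
  let s₄ : Hom ((X.dual.tensor X).tensor ((X.tpow m).tensor X.dual.dual))
      (X.tensor (X.tpow m)) :=
    X.snoc m ⊚ (Iso.leftUnit ((X.tpow m).tensor X)).hom ⊚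
      (Hom.ev X ⊗ₕ Hom.id (X.tpow m) ⊗ₕ (P.j X).inv)
  s₄ ⊚ s₃ ⊚ s₂ ⊚ s₁

/-- The linear endomorphism `E_X^{(m+1)}` of `Hom(𝟙, X^{⊗ (m+1)})`, where
`X^{⊗ (m+1)} = X ⊗ X^{⊗ m}`. -/
def E (P : PivotalStructure k H) (X : HopfRep k H) (m : ℕ) :
    Hom (unit k H) (X.tensor (X.tpow m)) →ₗ[k] Hom (unit k H) (X.tensor (X.tpow m)) where
  toFun := P.EFun X m
  map_add' f g := by
    apply Subtype.ext
    simp only [EFun, Hom.comp, Hom.tensor, Submodule.coe_add, TensorProduct.map_add_left,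
      TensorProduct.map_add_right, LinearMap.add_comp, LinearMap.comp_add]
  map_smul' c f := by
    apply Subtype.ext
    simp only [EFun, Hom.comp, Hom.tensor, Submodule.coe_smul, TensorProduct.map_smul_left,
      TensorProduct.map_smul_right, LinearMap.smul_comp, LinearMap.comp_smul, RingHom.id_apply]

/-- The `n`-th Frobenius–Schur indicator of `X`, the trace of `E_X^{(n)}`, for `n ≥ 1`.
(There is no zeroth indicator; the value at `0` is a placeholder.) -/
def indicator (P : PivotalStructure k H) (X : HopfRep k H) : ℕ → k
  | 0 => 0
  | m + 1 => LinearMap.trace k _ (P.E X m)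

end PivotalStructure

end
end HopfFS

/-! Let Λ be the normalized integral of H, h^{[n]} = h₁h₂⋯hₙ the Sweedler power, and λ the form on H
with λ(Λ₁)Λ₂ = 1. For the canonical pivotal structure, E_X^{(n)} is the cyclic rotation of X^{⊗n} on
invariants. Since Λ projects onto the invariants, ν_n(X) is the trace of rotation ∘ Λ on all of
X^{⊗n}, which is χ_X(Λ^{[n]}) (`indicator_eq_trace`). The regular character of H is λ
(`regularCharacter_eq_dualIntegral`), the normalized integral of H^* is λ/λ(1), and the regular
character of H^* is f ↦ λ(1) f(Λ) (`toForm_regularCharacter_dual`). Sweedler powers on H and H^* are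
transposes of each other (`toForm_sweedlerPower`), so ν_n(H^*) = λ^{[n]}(Λ) = λ(Λ^{[n]}) = ν_n(H).

All this rests on the Larson–Radford theorem S² = 1. Comparing the Nakayama automorphisms of λ and
of λ(· g), where g is the modular element, gives S⁴(h) g = g h; as g has finite order, so has S².
The element u = S(Λ₂)Λ₁ is invertible and implements S², so a power of u is central; a positivity
argument in each matrix block then gives Tr(S²) = λ(1) ≠ 0 (`toForm_dualIntegral_one_ne_zero`).
Hence λ/λ(1) is a normalized integral, H^* is semisimple by Maschke, g = 1 and S⁴ = 1. Finally the
regular character shows that Tr(S²) is a nonzero integral multiple of dim H, which for an involution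
fixing 1 forces S² = 1.

Once S² = 1, the evaluations V → V^{**} form a canonical pivotal structure. Any pivotal structure is
given by a central element z, and the dimension condition on the eigenspaces of z forces z = 1. -/

namespace HopfFS

noncomputable section

/-! ### Integrals in semisimple Hopf algebras -/

section Integrals

variable {k : Type*} {H : Type*} [Field k] [Ring H] [HopfAlgebra k H]

/-- A two-sided integral normalized by the counit. -/
structure IsNormalizedIntegral (k : Type*) {H : Type*} [Field k] [Ring H] [HopfAlgebra k H]
    (Λ : H) : Prop where
  mul_left : ∀ h : H, h * Λ = Coalgebra.counit (R := k) h • Λ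
  mul_right : ∀ h : H, Λ * h = Coalgebra.counit (R := k) h • Λ
  counit_eq : Coalgebra.counit (R := k) Λ = 1

/-- Left ideals are generated by idempotents: Hx = He with e = ax, and e = e² = a(xax) = 0. -/
theorem eq_zero_of_mul_mul_self [IsSemisimpleRing H] {x : H} (hx : ∀ h : H, x * h * x = 0) :
    x = 0 := by
  obtain ⟨e, he, hspan⟩ := IsSemisimpleRing.ideal_eq_span_idempotent (Ideal.span {x})
  have h1 : e ∈ Ideal.span {x} := by rw [hspan]; exact Ideal.mem_span_singleton_self e
  obtain ⟨a, rfl⟩ := Ideal.mem_span_singleton'.1 h1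
  have h2 : a * x = 0 := by
    rw [← he.eq, ← mul_assoc, mul_assoc a, mul_assoc a, hx, mul_zero]
  have h3 : x ∈ Ideal.span {a * x} := by rw [← hspan]; exact Ideal.mem_span_singleton_self x
  obtain ⟨b, hb⟩ := Ideal.mem_span_singleton'.1 h3
  rw [← hb, h2, mul_zero]

variable (k H) in
-- Λ is the component of 1 in a left ideal complementing ker ε: hΛ − ε(h)Λ lies both in that
-- complement and in ker ε.
theorem exists_isNormalizedIntegral [IsSemisimpleRing H] :
    ∃ Λ : H, IsNormalizedIntegral k Λ := by
  let ε : H →ₐ[k] k := Bialgebra.counitAlgHom k H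
  obtain ⟨I, hI⟩ := exists_isCompl (RingHom.ker ε.toRingHom : Ideal H)
  obtain ⟨a, ha, Λ, hΛ, hsum⟩ := Submodule.mem_sup.1
    (hI.sup_eq_top ▸ Submodule.mem_top : (1 : H) ∈ (RingHom.ker ε.toRingHom : Ideal H) ⊔ I)
  have hεa : ε a = 0 := ha
  have hε : ε Λ = 1 := by
    have := congrArg ε hsum
    rwa [map_add, hεa, zero_add, map_one] at this
  have hl : ∀ h : H, h * Λ = ε h • Λ := by
    intro h
    have h1 : h * Λ - ε h • Λ = (h - algebraMap k H (ε h)) * Λ := by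
      rw [sub_mul, Algebra.smul_def]
    have h2 : h * Λ - ε h • Λ ∈ (RingHom.ker ε.toRingHom : Ideal H) ⊓ I := by
      refine ⟨?_, ?_⟩
      · change ε (h * Λ - ε h • Λ) = 0
        simp [hε]
      · rw [h1]; exact I.mul_mem_left _ hΛ
    rw [hI.inf_eq_bot] at h2
    exact sub_eq_zero.1 h2
  refine ⟨Λ, hl, fun h => ?_, hε⟩
  -- The defect x = Λh − ε(h)Λ is again a left integral, with ε(x) = 0, so xgx = ε(xg)x = 0 for all
  -- g.
  have hz : ∀ g : H, g * (Λ * h - ε h • Λ) = ε g • (Λ * h - ε h • Λ) := by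
    intro g
    rw [mul_sub, ← mul_assoc, hl, mul_smul_comm, hl, smul_sub, smul_mul_assoc, smul_comm]
  have h0 : ε (Λ * h - ε h • Λ) = 0 := by simp [hε]
  refine sub_eq_zero.1 (eq_zero_of_mul_mul_self (x := Λ * h - ε h • Λ) fun g => ?_)
  rw [hz, map_mul, h0, zero_mul, zero_smul]

/-- Coassociativity turns the sum into h₁ ⊗ h₂S(h₃). The identity lets factors move across Δ(Λ) and
also inverts the Galois map a ⊗ b ↦ Δ(a)(1 ⊗ b). -/
theorem sum_comul_mul_antipode {ι : Type*} {h : H} (r : Coalgebra.Repr k h ι) :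
    ∑ i ∈ r.index, Coalgebra.comul (R := k) (r.left i) *
      ((1 : H) ⊗ₜ[k] HopfAlgebra.antipode k (r.right i)) = h ⊗ₜ[k] (1 : H) := by
  let Ψ : H ⊗[k] (H ⊗[k] H) →ₗ[k] H ⊗[k] H :=
    LinearMap.lTensor H (LinearMap.mul' k H ∘ₗ LinearMap.lTensor H (HopfAlgebra.antipode k))
  have h1 : ∀ (t : H ⊗[k] H) (c : H), Ψ (TensorProduct.assoc k H H H (t ⊗ₜ c)) =
      t * ((1 : H) ⊗ₜ[k] HopfAlgebra.antipode k c) := by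
    intro t c
    induction t with
    | zero => simp
    | add t t' ht ht' => simp only [TensorProduct.add_tmul, map_add, ht, ht', add_mul]
    | tmul a b => simp [Ψ]
  have key := congrArg Ψ (Coalgebra.coassoc_apply (R := k) h)
  have h2 : Ψ ∘ₗ LinearMap.lTensor H (Coalgebra.comul (R := k)) =
      LinearMap.lTensor H (Algebra.linearMap k H) ∘ₗ LinearMap.lTensor H Coalgebra.counit := by
    rw [← LinearMap.lTensor_comp, ← LinearMap.lTensor_comp, LinearMap.comp_assoc,
      HopfAlgebra.mul_antipode_lTensor_comul]
  have h3 : Ψ (LinearMap.lTensor H Coalgebra.comul (Coalgebra.comul (R := k) h)) =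
      h ⊗ₜ[k] (1 : H) := by
    rw [← LinearMap.comp_apply, h2, LinearMap.comp_apply, Coalgebra.lTensor_counit_comul]
    simp
  rw [h3] at key
  rw [← key]
  conv_rhs => rw [← r.eq]
  simp only [map_sum, LinearMap.rTensor_tmul, h1]

theorem sum_antipode_mul_comul {ι : Type*} {h : H} (r : Coalgebra.Repr k h ι) :
    ∑ i ∈ r.index, (HopfAlgebra.antipode k (r.left i) ⊗ₜ[k] (1 : H)) *
      Coalgebra.comul (R := k) (r.right i) = (1 : H) ⊗ₜ[k] h := by
  let Ψ : (H ⊗[k] H) ⊗[k] H →ₗ[k] H ⊗[k] H :=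
    LinearMap.rTensor H (LinearMap.mul' k H ∘ₗ LinearMap.rTensor H (HopfAlgebra.antipode k))
  have h1 : ∀ (t : H ⊗[k] H) (c : H), Ψ ((TensorProduct.assoc k H H H).symm (c ⊗ₜ t)) =
      (HopfAlgebra.antipode k c ⊗ₜ[k] (1 : H)) * t := by
    intro t c
    induction t with
    | zero => simp
    | add t t' ht ht' => simp only [TensorProduct.tmul_add, map_add, ht, ht', mul_add]
    | tmul a b => simp [Ψ]
  have key := congrArg Ψ (Coalgebra.coassoc_symm_apply (R := k) h)
  have h2 : Ψ ∘ₗ LinearMap.rTensor H (Coalgebra.comul (R := k)) =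
      LinearMap.rTensor H (Algebra.linearMap k H) ∘ₗ LinearMap.rTensor H Coalgebra.counit := by
    rw [← LinearMap.rTensor_comp, ← LinearMap.rTensor_comp, LinearMap.comp_assoc,
      HopfAlgebra.mul_antipode_rTensor_comul]
  have h3 : Ψ (LinearMap.rTensor H Coalgebra.comul (Coalgebra.comul (R := k) h)) =
      (1 : H) ⊗ₜ[k] h := by
    rw [← LinearMap.comp_apply, h2, LinearMap.comp_apply, Coalgebra.rTensor_counit_comul]
    simp
  rw [h3] at key
  rw [← key]
  conv_rhs => rw [← r.eq]
  simp only [map_sum, LinearMap.lTensor_tmul, h1]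

namespace IsNormalizedIntegral

variable {Λ : H} (hΛ : IsNormalizedIntegral k Λ)
include hΛ

/-- Expand h ⊗ 1 as ∑ Δ(h₁)(1 ⊗ S(h₂)) and absorb Δ(h₁) by Δ(Λ)Δ(h₁) = ε(h₁)Δ(Λ). -/
theorem comul_mul_tmul_one (h : H) :
    Coalgebra.comul (R := k) Λ * (h ⊗ₜ[k] (1 : H)) =
      Coalgebra.comul (R := k) Λ * ((1 : H) ⊗ₜ[k] HopfAlgebra.antipode k h) := by
  have r := Coalgebra.Repr.arbitrary k h
  rw [← sum_comul_mul_antipode r, Finset.mul_sum]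
  simp only [← mul_assoc, ← Bialgebra.comul_mul, hΛ.mul_right, map_smul, smul_mul_assoc]
  simp only [← mul_smul_comm, ← Finset.mul_sum]
  congr 1
  conv_rhs => rw [← Coalgebra.sum_counit_smul r]
  simp [TensorProduct.tmul_sum]

theorem tmul_one_mul_comul (h : H) :
    (HopfAlgebra.antipode k h ⊗ₜ[k] (1 : H)) * Coalgebra.comul (R := k) Λ =
      ((1 : H) ⊗ₜ[k] h) * Coalgebra.comul (R := k) Λ := by
  have r := Coalgebra.Repr.arbitrary k h
  rw [← sum_antipode_mul_comul r, Finset.sum_mul]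
  simp only [mul_assoc, ← Bialgebra.comul_mul, hΛ.mul_left, map_smul, mul_smul_comm]
  simp only [← smul_mul_assoc, ← Finset.sum_mul]
  congr 1
  have := congrArg (TensorProduct.lift ((LinearMap.lsmul k H).flip ))
    (Coalgebra.sum_tmul_counit_eq r)
  simp only [map_sum, TensorProduct.lift.tmul, LinearMap.flip_apply,
    LinearMap.lsmul_apply, one_smul] at this
  conv_lhs => rw [← this]
  simp [TensorProduct.sum_tmul, TensorProduct.smul_tmul']

end IsNormalizedIntegral

end Integrals
-- The Frobenius form (f, g) ↦ (f * g)(Λ) on the dual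
section DualForms

variable {k : Type*} {H : Type*} [Field k] [Ring H] [HopfAlgebra k H]

/-- The translate `x ↦ f (a x)` of a linear form. -/
def leftTranslate (a : H) : HopfDual k H →ₗ[k] HopfDual k H :=
  (toForm k H).symm.toLinearMap ∘ₗ (LinearMap.mulLeft k a).dualMap ∘ₗ (toForm k H).toLinearMap

/-- The translate `x ↦ f (x a)` of a linear form. -/
def rightTranslate (a : H) : HopfDual k H →ₗ[k] HopfDual k H :=
  (toForm k H).symm.toLinearMap ∘ₗ (LinearMap.mulRight k a).dualMap ∘ₗ (toForm k H).toLinearMap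

@[simp] theorem toForm_leftTranslate (a x : H) (f : HopfDual k H) :
    toForm k H (leftTranslate a f) x = toForm k H f (a * x) := rfl

@[simp] theorem toForm_rightTranslate (a x : H) (f : HopfDual k H) :
    toForm k H (rightTranslate a f) x = toForm k H f (x * a) := rfl

theorem dual_ext {f g : HopfDual k H} (h : ∀ x, toForm k H f x = toForm k H g x) : f = g :=
  (toForm k H).injective (LinearMap.ext h)

theorem toForm_mul_repr (f g : HopfDual k H) {ι : Type*} {a : H} (r : Coalgebra.Repr k a ι) :
    toForm k H (f * g) a = ∑ i ∈ r.index, toForm k H f (r.left i) * toForm k H g (r.right i) := by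
  rw [toForm_mul, ← r.eq]
  simp

theorem toForm_separating {x y : H} (h : ∀ f : HopfDual k H, toForm k H f x = toForm k H f y) :
    x = y := by
  rw [← sub_eq_zero, ← Module.forall_dual_apply_eq_zero_iff k]
  intro φ
  have := h ((toForm k H).symm φ)
  simp only [LinearEquiv.apply_symm_apply] at this
  rw [map_sub, this, sub_self]

theorem pair₂_comul (f g : HopfDual k H) (x : H) :
    pair₂ k H (f ⊗ₜ g) (Coalgebra.comul x) = toForm k H (f * g) x := by
  rw [toForm_mul, ← (Coalgebra.Repr.arbitrary k x).eq]
  simp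

theorem pair₂_mul_tmul (f g : HopfDual k H) (t : H ⊗[k] H) (a b : H) :
    pair₂ k H (f ⊗ₜ g) (t * (a ⊗ₜ b)) =
      pair₂ k H (rightTranslate a f ⊗ₜ rightTranslate b g) t := by
  induction t with
  | zero => simp
  | add t t' ht ht' => simp only [add_mul, map_add, ht, ht']
  | tmul c d => simp

theorem pair₂_tmul_mul (f g : HopfDual k H) (t : H ⊗[k] H) (a b : H) :
    pair₂ k H (f ⊗ₜ g) ((a ⊗ₜ b) * t) =
      pair₂ k H (leftTranslate a f ⊗ₜ leftTranslate b g) t := by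
  induction t with
  | zero => simp
  | add t t' ht ht' => simp only [mul_add, map_add, ht, ht']
  | tmul c d => simp

@[simp] theorem leftTranslate_one (f : HopfDual k H) : leftTranslate 1 f = f :=
  dual_ext fun x => by simp

@[simp] theorem rightTranslate_one (f : HopfDual k H) : rightTranslate 1 f = f :=
  dual_ext fun x => by simp

namespace IsNormalizedIntegral

variable {Λ : H} (hΛ : IsNormalizedIntegral k Λ)
include hΛ

/-- Translations by h and by S(h) are adjoint for the form (f, g) ↦ (f * g)(Λ). -/
theorem rightTranslate_mul (h : H) (f g : HopfDual k H) :
    toForm k H (rightTranslate h f * g) Λ =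
      toForm k H (f * rightTranslate (HopfAlgebra.antipode k h) g) Λ := by
  have := congrArg (pair₂ k H (f ⊗ₜ g)) (hΛ.comul_mul_tmul_one h)
  rwa [pair₂_mul_tmul, pair₂_mul_tmul, rightTranslate_one, rightTranslate_one, pair₂_comul,
    pair₂_comul] at this

theorem leftTranslate_mul (h : H) (f g : HopfDual k H) :
    toForm k H (leftTranslate (HopfAlgebra.antipode k h) f * g) Λ =
      toForm k H (f * leftTranslate h g) Λ := by
  have := congrArg (pair₂ k H (f ⊗ₜ g)) (hΛ.tmul_one_mul_comul h)
  rwa [pair₂_tmul_mul, pair₂_tmul_mul, leftTranslate_one, leftTranslate_one, pair₂_comul,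
    pair₂_comul] at this

end IsNormalizedIntegral

/-- The map `f ↦ f(a₁) a₂`. -/
def contractFst (a : H) : HopfDual k H →ₗ[k] H where
  toFun f := TensorProduct.lid k H ((toForm k H f).rTensor H (Coalgebra.comul a))
  map_add' f g := by simp
  map_smul' c f := by simp

/-- The map `f ↦ a₁ f(a₂)`. -/
def contractSnd (a : H) : HopfDual k H →ₗ[k] H where
  toFun f := TensorProduct.rid k H ((toForm k H f).lTensor H (Coalgebra.comul a))
  map_add' f g := by simp
  map_smul' c f := by simp

theorem contractFst_repr (f : HopfDual k H) {ι : Type*} {a : H} (r : Coalgebra.Repr k a ι) :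
    contractFst a f = ∑ i ∈ r.index, toForm k H f (r.left i) • r.right i := by
  simp [contractFst, ← r.eq]

theorem contractSnd_repr (f : HopfDual k H) {ι : Type*} {a : H} (r : Coalgebra.Repr k a ι) :
    contractSnd a f = ∑ i ∈ r.index, toForm k H f (r.right i) • r.left i := by
  simp [contractSnd, ← r.eq]

@[simp] theorem toForm_contractFst (f g : HopfDual k H) (a : H) :
    toForm k H g (contractFst a f) = toForm k H (f * g) a := by
  rw [contractFst_repr f (Coalgebra.Repr.arbitrary k a),
    toForm_mul_repr f g (Coalgebra.Repr.arbitrary k a)]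
  simp

@[simp] theorem toForm_contractSnd (f g : HopfDual k H) (a : H) :
    toForm k H g (contractSnd a f) = toForm k H (g * f) a := by
  rw [contractSnd_repr f (Coalgebra.Repr.arbitrary k a),
    toForm_mul_repr g f (Coalgebra.Repr.arbitrary k a)]
  simp [mul_comm]

variable [FiniteDimensional k H]

namespace IsNormalizedIntegral

variable {Λ : H} (hΛ : IsNormalizedIntegral k Λ)
include hΛ

/-- This makes the range of f ↦ f(Λ₁)Λ₂ a left ideal, so surjectivity only needs 1 in the range. -/
theorem mul_contractFst (h : H) (f : HopfDual k H) :
    h * contractFst Λ f = contractFst Λ (leftTranslate (HopfAlgebra.antipode k h) f) :=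
  toForm_separating (k := k) fun g => by
    rw [← toForm_leftTranslate, toForm_contractFst, toForm_contractFst, hΛ.leftTranslate_mul]

/-- The antipode axiom S(Λ₁)Λ₂ = ε(Λ)1 = 1 writes 1 as a left combination of elements of the range.
-/
theorem one_mem_range_contractFst : (1 : H) ∈ LinearMap.range (contractFst (k := k) Λ) := by
  let b := Module.finBasis k H
  have hb : Coalgebra.comul (R := k) Λ =
      ∑ i, b i ⊗ₜ[k] contractFst Λ ((toForm k H).symm (b.coord i)) := by
    rw [← (Coalgebra.Repr.arbitrary k Λ).eq]
    simp only [contractFst_repr _ (Coalgebra.Repr.arbitrary k Λ), TensorProduct.tmul_sum]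
    rw [Finset.sum_comm]
    refine Finset.sum_congr rfl fun j _ => ?_
    conv_lhs => rw [← b.sum_repr ((Coalgebra.Repr.arbitrary k Λ).left j)]
    simp only [TensorProduct.sum_tmul, TensorProduct.smul_tmul]
    rfl
  have h1 : (1 : H) = ∑ i, HopfAlgebra.antipode k (b i) *
      contractFst Λ ((toForm k H).symm (b.coord i)) := by
    have := HopfAlgebra.mul_antipode_rTensor_comul_apply (R := k) Λ
    rw [hb, hΛ.counit_eq, map_one] at this
    rw [← this]
    simp
  rw [h1]
  refine Submodule.sum_mem _ fun i _ => ?_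
  rw [hΛ.mul_contractFst]
  exact LinearMap.mem_range_self _ _

theorem contractFst_bijective : Function.Bijective (contractFst (k := k) Λ) := by
  have hs : Function.Surjective (contractFst (k := k) Λ) := by
    obtain ⟨f, hf⟩ := hΛ.one_mem_range_contractFst
    intro h
    exact ⟨_, by rw [← hΛ.mul_contractFst h f, hf, mul_one]⟩
  refine ⟨?_, hs⟩
  have hd : Module.finrank k (HopfDual k H) = Module.finrank k H := by
    rw [LinearEquiv.finrank_eq (toForm k H), Subspace.dual_finrank_eq]
  exact (LinearMap.injective_iff_surjective_of_finrank_eq_finrank hd).2 hs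

theorem eq_of_mul_right {f f' : HopfDual k H}
    (h : ∀ g, toForm k H (f * g) Λ = toForm k H (f' * g) Λ) : f = f' :=
  hΛ.contractFst_bijective.1 <| toForm_separating (k := k) fun g => by simp [h]

theorem eq_of_mul_left {g g' : HopfDual k H}
    (h : ∀ f, toForm k H (f * g) Λ = toForm k H (f * g') Λ) : g = g' :=
  dual_ext fun x => by
    obtain ⟨f, rfl⟩ := hΛ.contractFst_bijective.2 x
    simp [h]

theorem contractSnd_bijective : Function.Bijective (contractSnd (k := k) Λ) := by
  have hi : Function.Injective (contractSnd (k := k) Λ) := fun g g' h =>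
    hΛ.eq_of_mul_left fun f => by rw [← toForm_contractSnd, h, toForm_contractSnd]
  refine ⟨hi, ?_⟩
  have hd : Module.finrank k (HopfDual k H) = Module.finrank k H := by
    rw [LinearEquiv.finrank_eq (toForm k H), Subspace.dual_finrank_eq]
  exact (LinearMap.injective_iff_surjective_of_finrank_eq_finrank hd).1 hi

/-- Choose g with Λ₁g(Λ₂) = 1. Then f(h) = (f(· h) * g)(Λ) = (f * g(· S(h)))(Λ), which vanishes for
every f when S(h) = 0. -/
theorem antipode_bijective : Function.Bijective (HopfAlgebra.antipode k (A := H)) := by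
  have hi : Function.Injective (HopfAlgebra.antipode k (A := H)) := by
    rw [injective_iff_map_eq_zero]
    intro h hh
    obtain ⟨g, hg⟩ := hΛ.contractSnd_bijective.2 1
    refine toForm_separating (k := k) fun f => ?_
    have h1 := hΛ.rightTranslate_mul h f g
    rw [hh, ← toForm_contractSnd, hg, toForm_rightTranslate, one_mul] at h1
    have h0 : rightTranslate (k := k) (0 : H) g = 0 := dual_ext fun x => by simp
    rw [h1, h0, mul_zero]
    simp
  exact ⟨hi, LinearMap.injective_iff_surjective.1 hi⟩

/-- S(Λ) is a left integral because S is onto; evaluating Λ S(Λ) in two ways gives both Λ and S(Λ).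
-/
theorem antipode_eq : HopfAlgebra.antipode k Λ = Λ := by
  have h1 : ∀ h : H, h * HopfAlgebra.antipode k Λ =
      Coalgebra.counit (R := k) h • HopfAlgebra.antipode k Λ := by
    intro h
    obtain ⟨h, rfl⟩ := hΛ.antipode_bijective.2 h
    rw [← HopfAlgebra.antipode_mul_antidistrib, hΛ.mul_right, map_smul,
      HopfAlgebra.counit_antipode]
  have h2 := hΛ.mul_right (HopfAlgebra.antipode k Λ)
  rw [h1, HopfAlgebra.counit_antipode, hΛ.counit_eq, one_smul, one_smul] at h2
  exact h2

end IsNormalizedIntegral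

/-- The linear form `λ` on `H` with `λ(Λ₁) Λ₂ = 1`. -/
def dualIntegral {Λ : H} (hΛ : IsNormalizedIntegral k Λ) : HopfDual k H :=
  (LinearEquiv.ofBijective _ hΛ.contractFst_bijective).symm 1

/-! ### The integral λ, its Nakayama automorphism and the modular element -/

section

variable {Λ : H} (hΛ : IsNormalizedIntegral k Λ)

local notation "lam" => dualIntegral hΛ

theorem contractFst_dualIntegral : contractFst Λ lam = 1 :=
  (LinearEquiv.ofBijective _ hΛ.contractFst_bijective).apply_symm_apply 1

theorem toForm_dualIntegral_mul (g : HopfDual k H) :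
    toForm k H (lam * g) Λ = toForm k H g 1 := by
  rw [← toForm_contractFst, contractFst_dualIntegral]

theorem dualIntegral_mul (g : HopfDual k H) : lam * g = toForm k H g 1 • lam :=
  hΛ.eq_of_mul_right fun x => by
    rw [mul_assoc, toForm_dualIntegral_mul, toForm_mul, smul_mul_assoc, map_smul,
      LinearMap.smul_apply, toForm_dualIntegral_mul]
    simp [Algebra.TensorProduct.one_def]

theorem toForm_dualIntegral : toForm k H lam Λ = 1 := by
  have := toForm_dualIntegral_mul hΛ 1
  rwa [mul_one, toForm_one, Bialgebra.counit_one] at this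

/-- Under the Frobenius form, λ(· x) represents evaluation at S(x), while λ(S(y) ·) represents
evaluation at y. Matching the two gives the Nakayama automorphism of λ. -/
theorem toForm_rightTranslate_dualIntegral_mul (x : H) (g : HopfDual k H) :
    toForm k H (rightTranslate x lam * g) Λ = toForm k H g (HopfAlgebra.antipode k x) := by
  rw [hΛ.rightTranslate_mul, toForm_dualIntegral_mul, toForm_rightTranslate, one_mul]

theorem toForm_leftTranslate_dualIntegral_mul (y : H) (g : HopfDual k H) :
    toForm k H (leftTranslate (HopfAlgebra.antipode k y) lam * g) Λ = toForm k H g y := by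
  rw [hΛ.leftTranslate_mul, toForm_dualIntegral_mul, toForm_leftTranslate, mul_one]

/-- The Nakayama automorphism of `λ` is the square of the antipode. -/
theorem toForm_dualIntegral_mul_comm (a x : H) :
    toForm k H lam (a * x) =
      toForm k H lam (HopfAlgebra.antipode k (HopfAlgebra.antipode k x) * a) := by
  have : rightTranslate x lam =
      leftTranslate (HopfAlgebra.antipode k (HopfAlgebra.antipode k x)) lam :=
    hΛ.eq_of_mul_right fun g => by
      rw [toForm_rightTranslate_dualIntegral_mul, toForm_leftTranslate_dualIntegral_mul]
  exact LinearMap.congr_fun (congrArg (toForm k H) this) a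

/-- Nondegeneracy of λ: with x = S(x'), the form λ(x ·) determines every value g(x') = (λ(x ·) *
g)(Λ). -/
theorem eq_of_toForm_dualIntegral {x y : H}
    (h : ∀ a, toForm k H lam (x * a) = toForm k H lam (y * a)) : x = y := by
  obtain ⟨x, rfl⟩ := hΛ.antipode_bijective.2 x
  obtain ⟨y, rfl⟩ := hΛ.antipode_bijective.2 y
  congr 1
  refine toForm_separating (k := k) fun g => ?_
  rw [← toForm_leftTranslate_dualIntegral_mul hΛ, ← toForm_leftTranslate_dualIntegral_mul hΛ y]
  congr 3
  exact dual_ext h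

/-- The distinguished group-like element. -/
def modularElement : H := contractSnd Λ lam

theorem mul_dualIntegral (f : HopfDual k H) :
    f * lam = toForm k H f (modularElement hΛ) • lam :=
  hΛ.eq_of_mul_right fun x => by
    rw [mul_assoc, dualIntegral_mul, mul_smul_comm, smul_mul_assoc, map_smul, map_smul,
      LinearMap.smul_apply, LinearMap.smul_apply, toForm_dualIntegral_mul, modularElement,
      toForm_contractSnd, smul_eq_mul, smul_eq_mul, mul_comm]

/-- Left multiplication acts on the line spanned by λ through a character of H^*, namely evaluation
at the modular element. -/
theorem toForm_modularElement_mul (f g : HopfDual k H) :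
    toForm k H (f * g) (modularElement hΛ) =
      toForm k H f (modularElement hΛ) * toForm k H g (modularElement hΛ) := by
  have h : (f * g) * lam = _ := mul_assoc f g lam
  rw [mul_dualIntegral, mul_dualIntegral, mul_smul_comm, mul_dualIntegral, smul_smul] at h
  have := LinearMap.congr_fun (congrArg (toForm k H) h) Λ
  simpa [toForm_dualIntegral, mul_comm] using this

theorem isGroupLikeElem_modularElement : IsGroupLikeElem k (modularElement hΛ) where
  counit_eq_one := by
    rw [← toForm_one, modularElement, toForm_contractSnd, one_mul, toForm_dualIntegral]
  comul_eq_tmul_self := by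
    refine (Module.forall_dual_apply_eq_zero_iff k _).1 (fun φ => ?_) |> sub_eq_zero.1
    obtain ⟨z, rfl⟩ := (pairEquiv k H).surjective φ
    rw [pairEquiv_apply, map_sub, sub_eq_zero]
    induction z with
    | zero => simp
    | add z z' hz hz' => simp only [map_add, LinearMap.add_apply, hz, hz']
    | tmul f g => rw [pair₂_comul, pair₂_tmul, toForm_modularElement_mul]

local notation "gr" => modularElement hΛ

/-- Right translation by a group-like element is multiplicative on H^*; here it turns the right
integral λ into a left integral. -/
theorem mul_rightTranslate_modularElement (f : HopfDual k H) :
    f * rightTranslate gr lam = toForm k H f 1 • rightTranslate gr lam := by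
  have hg := isGroupLikeElem_modularElement hΛ
  have key : ∀ x : H, toForm k H (f * rightTranslate gr lam) x =
      toForm k H (rightTranslate (HopfAlgebra.antipode k gr) f * lam) (x * gr) := by
    intro x
    have r := Coalgebra.Repr.arbitrary k x
    rw [toForm_mul_repr _ _ r, toForm_mul, Bialgebra.comul_mul, hg.comul_eq_tmul_self, ← r.eq]
    simp [Finset.sum_mul, mul_assoc, hg.mul_antipode_cancel]
  refine dual_ext fun x => ?_
  rw [key, mul_dualIntegral]
  simp [hg.mul_antipode_cancel]

theorem toForm_mul_rightTranslate_modularElement (f : HopfDual k H) :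
    toForm k H (f * rightTranslate gr lam) Λ = toForm k H f 1 := by
  rw [mul_rightTranslate_modularElement, map_smul, LinearMap.smul_apply, toForm_rightTranslate,
    hΛ.mul_right, (isGroupLikeElem_modularElement hΛ).counit_eq_one, one_smul,
    toForm_dualIntegral, smul_eq_mul, mul_one]

/-- The Nakayama computation carried out for the left integral λ(· g), with g the modular element,
pairing from the other side. -/
theorem toForm_mul_modularElement_comm (a h : H) :
    toForm k H lam (h * a * gr) =
      toForm k H lam (a * HopfAlgebra.antipode k (HopfAlgebra.antipode k h) * gr) := by
  have : leftTranslate h (rightTranslate gr lam) =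
      rightTranslate (HopfAlgebra.antipode k (HopfAlgebra.antipode k h))
        (rightTranslate gr lam) :=
    hΛ.eq_of_mul_left fun f => by
      rw [← hΛ.leftTranslate_mul, ← hΛ.rightTranslate_mul,
        toForm_mul_rightTranslate_modularElement, toForm_mul_rightTranslate_modularElement]
      simp
  exact LinearMap.congr_fun (congrArg (toForm k H) this) a

/-- Radford's formula for the fourth power of the antipode, in the unimodular case. -/
theorem antipode_pow_four (h : H) :
    HopfAlgebra.antipode k (HopfAlgebra.antipode k (HopfAlgebra.antipode k
      (HopfAlgebra.antipode k h))) * gr = gr * h := by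
  have hg := isGroupLikeElem_modularElement hΛ
  refine eq_of_toForm_dualIntegral hΛ fun a => ?_
  -- Moving the last factors of λ(h a g) = λ(a S²(h) g) to the front by the Nakayama rule for λ
  -- yields λ(g h a) = λ(S⁴(h) g a) for all a.
  have h1 := toForm_mul_modularElement_comm hΛ a h
  rw [toForm_dualIntegral_mul_comm hΛ (h * a) gr, hg.antipode_antipode,
    mul_assoc a, toForm_dualIntegral_mul_comm hΛ a, HopfAlgebra.antipode_mul_antidistrib,
    HopfAlgebra.antipode_mul_antidistrib, hg.antipode_antipode] at h1
  rw [mul_assoc gr, h1]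

/-- Group-like elements are linearly independent, so in finite dimension they form a finite group.
-/
theorem exists_modularElement_pow_eq_one : ∃ m : ℕ, 0 < m ∧ modularElement hΛ ^ m = 1 := by
  have hg := isGroupLikeElem_modularElement hΛ
  have hfin : Finite (GroupLike k H) := (linearIndep_groupLikeVal (R := k) (A := H)).finite
  obtain ⟨m, hm, h1⟩ := isOfFinOrder_iff_pow_eq_one.1
    (isOfFinOrder_of_finite (⟨gr, hg⟩ : GroupLike k H))
  exact ⟨m, hm, by simpa using congrArg GroupLike.val h1⟩

end

end DualForms

/-! ### Inner automorphisms of finite order of semisimple algebras -/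

section Positivity

/-- Weyl's unitary trick: w is unitary for the averaged positive form P = ∑ (wⁱ)*wⁱ, so w⁻¹ =
P⁻¹w*P. -/
theorem trace_eq_star_trace_of_pow_eq_one {n : Type*} [Fintype n] [DecidableEq n]
    {w v : Matrix n n ℂ} {N : ℕ} (hw : w ^ N = 1) (hN : 0 < N) (hv : w * v = 1) :
    v.trace = star w.trace := by
  open scoped ComplexOrder in
  let f : ℕ → Matrix n n ℂ := fun i => (w ^ i).conjTranspose * w ^ i
  let P : Matrix n n ℂ := ∑ i ∈ Finset.range N, f i
  have hP : P.PosDef := by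
    obtain ⟨m, rfl⟩ : ∃ m, N = m + 1 := ⟨N - 1, by omega⟩
    simp only [P, Finset.sum_range_succ']
    refine Matrix.PosDef.posSemidef_add
      (Matrix.posSemidef_sum _ fun i _ => Matrix.posSemidef_conjTranspose_mul_self _) ?_
    simpa [f] using Matrix.PosDef.one
  have h1 : w.conjTranspose * P * w = P := by
    have h2 : w.conjTranspose * P * w = ∑ i ∈ Finset.range N, f (i + 1) := by
      simp only [P, Finset.mul_sum, Finset.sum_mul]
      refine Finset.sum_congr rfl fun i _ => ?_
      simp only [f, pow_succ, Matrix.conjTranspose_mul, mul_assoc]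
    have h3 := Finset.sum_range_succ' f N
    rw [Finset.sum_range_succ] at h3
    have h4 : f N = f 0 := by simp only [f, hw, pow_zero]
    rw [h4] at h3
    rw [h2]
    exact (add_right_cancel h3).symm
  obtain ⟨U, hU⟩ := hP.isUnit
  let R : Matrix n n ℂ := ↑U⁻¹
  have hPR : P * R = 1 := by rw [← hU]; exact U.mul_inv
  have hRP : R * P = 1 := by rw [← hU]; exact U.inv_mul
  have h5 : v = R * (w.conjTranspose * P) := by
    have : w.conjTranspose * P = P * v := by
      conv_rhs => rw [← h1]
      rw [mul_assoc _ w v, hv, mul_one]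
    rw [this, ← mul_assoc, hRP, one_mul]
  rw [h5, Matrix.trace_mul_comm, mul_assoc, hPR, mul_one, Matrix.trace_conjTranspose]

/-- Dividing w by an N-th root r of c gives a matrix of finite order, and tr(w) tr(w⁻¹) =
|tr(w/r)|². -/
theorem trace_mul_trace_inv {n : Type*} [Fintype n] [DecidableEq n]
    {w v : Matrix n n ℂ} {N : ℕ} {c : ℂ} (hw : w ^ N = c • 1) (hN : 0 < N)
    (hwv : w * v = 1) (hvw : v * w = 1) :
    ∃ t : ℝ, 0 ≤ t ∧ w.trace * v.trace = t ∧ (w.trace ≠ 0 → 0 < t) := by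
  -- Since w is invertible, c = 0 can occur only for matrices of size zero.
  by_cases hc : c = 0
  · have h1 : w ^ N * v ^ N = 1 := by
      rw [← (show Commute w v from hwv.trans hvw.symm).mul_pow, hwv, one_pow]
    have h2 : (1 : Matrix n n ℂ) = 0 := by rw [← h1, hw, hc, zero_smul, zero_mul]
    have h3 : w = 0 := by rw [← mul_one w, h2, mul_zero]
    exact ⟨0, le_rfl, by simp [h3], by simp [h3]⟩
  obtain ⟨r, hr⟩ := IsAlgClosed.exists_pow_nat_eq c hN
  have hr0 : r ≠ 0 := by
    rintro rfl
    rw [zero_pow hN.ne'] at hr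
    exact hc hr.symm
  have h1 : (r⁻¹ • w) ^ N = 1 := by
    rw [smul_pow, hw, smul_smul, inv_pow, hr, inv_mul_cancel₀ hc, one_smul]
  have h2 : (r⁻¹ • w) * (r • v) = 1 := by
    rw [smul_mul_smul_comm, hwv, inv_mul_cancel₀ hr0, one_smul]
  have h3 := trace_eq_star_trace_of_pow_eq_one h1 hN h2
  refine ⟨Complex.normSq (r⁻¹ • w).trace, Complex.normSq_nonneg _, ?_, fun h => ?_⟩
  · rw [← Complex.mul_conj, starRingEnd_apply, ← h3, Matrix.trace_smul, Matrix.trace_smul,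
      smul_eq_mul, smul_eq_mul, mul_mul_mul_comm, inv_mul_cancel₀ hr0, one_mul]
  · refine Complex.normSq_pos.2 ?_
    rw [Matrix.trace_smul, smul_eq_mul]
    exact mul_ne_zero (inv_ne_zero hr0) h

variable {m : ℕ} {d : Fin m → ℕ}

theorem trace_mulLeft_comp_mulRight (a b : Π i, Matrix (Fin (d i)) (Fin (d i)) ℂ) :
    LinearMap.trace ℂ _ (LinearMap.mulLeft ℂ a ∘ₗ LinearMap.mulRight ℂ b) =
      ∑ i, (a i).trace * (b i).trace := by
  classical
  rw [LinearMap.trace_eq_matrix_trace ℂ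
    (Pi.basis fun i => Matrix.stdBasis ℂ (Fin (d i)) (Fin (d i)))]
  simp only [Matrix.trace, Matrix.diag, LinearMap.toMatrix_apply]
  rw [Fintype.sum_sigma]
  refine Finset.sum_congr rfl fun i _ => ?_
  rw [Finset.sum_mul_sum, Fintype.sum_prod_type]
  refine Finset.sum_congr rfl fun p _ => Finset.sum_congr rfl fun q _ => ?_
  rw [Pi.basis_repr, Pi.basis_apply, Matrix.stdBasis_eq_single]
  simp [Matrix.stdBasis, Matrix.mul_apply, Matrix.single_apply, ite_and]

theorem eq_smul_one_of_central {z : Π i, Matrix (Fin (d i)) (Fin (d i)) ℂ}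
    (hz : ∀ x, z * x = x * z) (i : Fin m) : ∃ c : ℂ, z i = c • 1 := by
  have h : z i ∈ Set.range (Matrix.scalar (Fin (d i))) := by
    rw [Matrix.mem_range_scalar_iff_commute_single']
    intro p q
    have := congrFun (hz (Pi.single i (Matrix.single p q 1))) i
    simp only [Pi.mul_apply, Pi.single_eq_same] at this
    exact this.symm
  obtain ⟨c, hc⟩ := h
  exact ⟨c, by rw [← hc, Matrix.smul_one_eq_diagonal]; rfl⟩

/-- In the Wedderburn decomposition, the trace of x ↦ w x v is ∑ tr(wᵢ) tr(vᵢ) with all terms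
nonnegative. Since z is scalar in each block, the nonzero trace of wz forces some tr(wᵢ) ≠ 0, and
that term is positive. -/
theorem trace_conj_ne_zero {A : Type*} [Ring A] [Algebra ℂ A] [FiniteDimensional ℂ A]
    [IsSemisimpleRing A] {w v z : A} {N : ℕ} (hN : 0 < N) (hwv : w * v = 1) (hvw : v * w = 1)
    (hw : ∀ x, w ^ N * x = x * w ^ N) (hz : ∀ x, z * x = x * z)
    (htr : LinearMap.trace ℂ A (LinearMap.mulLeft ℂ (w * z)) ≠ 0) :
    LinearMap.trace ℂ A (LinearMap.mulLeft ℂ w ∘ₗ LinearMap.mulRight ℂ v) ≠ 0 := by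
  obtain ⟨m, d, -, ⟨e⟩⟩ := IsSemisimpleRing.exists_algEquiv_pi_matrix_of_isAlgClosed ℂ A
  have key : ∀ a b : A, LinearMap.trace ℂ A (LinearMap.mulLeft ℂ a ∘ₗ LinearMap.mulRight ℂ b) =
      ∑ i, (e a i).trace * (e b i).trace := by
    intro a b
    rw [← trace_mulLeft_comp_mulRight, ← LinearMap.trace_conj' _ e.toLinearEquiv]
    congr 1
    refine LinearMap.ext fun x => ?_
    simp [LinearEquiv.conj_apply]
  have hcent : ∀ y : A, (∀ x, y * x = x * y) → ∀ i, ∃ c : ℂ, e y i = c • 1 := by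
    intro y hy i
    refine eq_smul_one_of_central (fun x => ?_) i
    obtain ⟨x, rfl⟩ := e.surjective x
    rw [← map_mul, ← map_mul, hy]
  have h1 : ∀ i, ∃ t : ℝ, 0 ≤ t ∧ (e w i).trace * (e v i).trace = t ∧
      ((e w i).trace ≠ 0 → 0 < t) := by
    intro i
    obtain ⟨c, hc⟩ := hcent _ hw i
    refine trace_mul_trace_inv (c := c) ?_ hN ?_ ?_
    · rw [← hc, map_pow, Pi.pow_apply]
    · rw [← Pi.mul_apply, ← map_mul, hwv, map_one, Pi.one_apply]
    · rw [← Pi.mul_apply, ← map_mul, hvw, map_one, Pi.one_apply]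
  choose t ht0 ht htpos using h1
  have h2 : LinearMap.mulLeft ℂ (w * z) = LinearMap.mulLeft ℂ (w * z) ∘ₗ LinearMap.mulRight ℂ 1 := by
    ext x; simp
  obtain ⟨i, hi⟩ : ∃ i, (e w i).trace ≠ 0 := by
    by_contra! h
    apply htr
    rw [h2, key]
    refine Finset.sum_eq_zero fun i _ => ?_
    obtain ⟨c, hc⟩ := hcent z hz i
    rw [map_mul, Pi.mul_apply, hc, Matrix.mul_smul, mul_one, Matrix.trace_smul, h, smul_zero,
      zero_mul]
  rw [key]
  simp only [ht]
  rw [← Complex.ofReal_sum, Complex.ofReal_ne_zero]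
  exact (Finset.sum_pos' (fun i _ => ht0 i) ⟨i, Finset.mem_univ i, htpos i hi⟩).ne'

end Positivity

/-! ### Traces of endomorphisms in terms of integrals -/

section Traces

variable {k : Type*} {H : Type*} [Field k] [Ring H] [HopfAlgebra k H] [FiniteDimensional k H]
variable {Λ : H} (hΛ : IsNormalizedIntegral k Λ)

local notation "lam" => dualIntegral hΛ
local notation "S" => HopfAlgebra.antipode k (A := H)

/-- Radford's trace formula. -/
theorem trace_eq_sum (F : H →ₗ[k] H) {ι : Type*} (r : Coalgebra.Repr k Λ ι) :
    LinearMap.trace k H F = ∑ i ∈ r.index, toForm k H lam (S (F (r.right i)) * r.left i) := by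
  -- Dual bases for λ: x = ∑ λ(S(x)Λ₁)Λ₂, so F is a sum of rank-one maps.
  have hF : F = ∑ i ∈ r.index, LinearMap.smulRight
      (toForm k H lam ∘ₗ LinearMap.mulRight k (r.left i) ∘ₗ S) (F (r.right i)) := by
    ext x
    refine (congrArg F (?_ : x = ∑ i ∈ r.index,
      toForm k H lam (S x * r.left i) • r.right i)).trans (by simp)
    refine toForm_separating (k := k) fun g => ?_
    rw [← toForm_leftTranslate_dualIntegral_mul hΛ, toForm_mul_repr _ _ r]
    simp
  conv_lhs => rw [hF]
  simp [LinearMap.trace_smulRight]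

/-- By the trace formula and the Nakayama rule, the trace is λ(Λ₁S(Λ₂)) f(Λ₃), and the antipode
axiom collapses the first two factors. -/
theorem trace_antipode_sq_comp_contractSnd (f : HopfDual k H) (F : H →ₗ[k] H)
    (hF : ∀ h, F h = S (S (contractSnd h f))) :
    LinearMap.trace k H F = toForm k H lam 1 * toForm k H f Λ := by
  have r := Coalgebra.Repr.arbitrary k Λ
  rw [trace_eq_sum hΛ F r]
  let Ψ : H ⊗[k] (H ⊗[k] H) →ₗ[k] k :=
    LinearMap.mul' k k ∘ₗ TensorProduct.map
      (toForm k H lam ∘ₗ LinearMap.mul' k H ∘ₗ LinearMap.lTensor H S) (toForm k H f) ∘ₗ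
      (TensorProduct.assoc k H H H).symm.toLinearMap
  have key := congrArg Ψ (Coalgebra.coassoc_apply (R := k) Λ)
  have h1 : ∀ x y : H, Ψ (x ⊗ₜ Coalgebra.comul y) = toForm k H lam (x * S (contractSnd y f)) := by
    intro x y
    rw [contractSnd_repr f (Coalgebra.Repr.arbitrary k y), ← (Coalgebra.Repr.arbitrary k y).eq]
    simp [Ψ, TensorProduct.tmul_sum, Finset.mul_sum, mul_comm]
  have h2 : ∀ x y : H, Ψ (TensorProduct.assoc k H H H (Coalgebra.comul x ⊗ₜ y)) =
      Coalgebra.counit (R := k) x * toForm k H lam 1 * toForm k H f y := by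
    intro x y
    simp [Ψ, Algebra.algebraMap_eq_smul_one]
  rw [← r.eq] at key
  simp only [map_sum, LinearMap.rTensor_tmul, LinearMap.lTensor_tmul, h1, h2] at key
  simp only [hF, ← toForm_dualIntegral_mul_comm hΛ]
  rw [← key]
  have hf : toForm k H f Λ = ∑ i ∈ r.index,
      Coalgebra.counit (R := k) (r.left i) * toForm k H f (r.right i) := by
    conv_lhs => rw [← Coalgebra.sum_counit_smul r]
    simp
  rw [hf, Finset.mul_sum]
  exact Finset.sum_congr rfl fun i _ => by ring

theorem trace_antipode_sq : LinearMap.trace k H (S ∘ₗ S) = toForm k H lam 1 := by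
  rw [trace_antipode_sq_comp_contractSnd hΛ 1, toForm_one, hΛ.counit_eq, mul_one]
  intro h
  have h1 : contractSnd (k := k) h 1 = h := toForm_separating (k := k) fun g => by simp
  rw [h1, LinearMap.comp_apply]

/-- The element `S(Λ₂) Λ₁`, which implements the square of the antipode. -/
def drinfeldElement (k : Type*) {H : Type*} [Field k] [Ring H] [HopfAlgebra k H] (Λ : H) : H :=
  LinearMap.mul' k H (LinearMap.rTensor H (HopfAlgebra.antipode k)
    (TensorProduct.comm k H H (Coalgebra.comul Λ)))

theorem drinfeldElement_repr {ι : Type*} (r : Coalgebra.Repr k Λ ι) :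
    drinfeldElement k Λ = ∑ i ∈ r.index, S (r.right i) * r.left i := by
  simp [drinfeldElement, ← r.eq]

local notation "dr" => drinfeldElement k Λ

theorem trace_mulRight (h : H) :
    LinearMap.trace k H (LinearMap.mulRight k h) = toForm k H lam (S h * dr) := by
  rw [trace_eq_sum hΛ _ (Coalgebra.Repr.arbitrary k Λ),
    drinfeldElement_repr (Coalgebra.Repr.arbitrary k Λ)]
  simp [Finset.mul_sum, HopfAlgebra.antipode_mul_antidistrib, mul_assoc]

include hΛ in
-- Apply a ⊗ b ↦ S(b)a to Δ(Λ)(h ⊗ 1) = Δ(Λ)(1 ⊗ S(h)).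
theorem drinfeldElement_mul (h : H) : dr * h = S (S h) * dr := by
  have := congrArg (LinearMap.mul' k H ∘ₗ LinearMap.rTensor H S ∘ₗ
    (TensorProduct.comm k H H).toLinearMap) (hΛ.comul_mul_tmul_one h)
  rw [drinfeldElement_repr (Coalgebra.Repr.arbitrary k Λ)]
  rw [← (Coalgebra.Repr.arbitrary k Λ).eq] at this
  simpa [Finset.sum_mul, Finset.mul_sum, HopfAlgebra.antipode_mul_antidistrib, mul_assoc] using this

include hΛ in
-- Write u for `drinfeldElement`. The left ideal {a | S(a)u = 0} is generated by an idempotent e.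
-- Right multiplication by e is a projection of trace λ(S(e)u) = 0, hence zero in characteristic
-- zero, so the ideal vanishes and u is not annihilated from the left.
theorem exists_inverse_drinfeldElement [CharZero k] [IsSemisimpleRing H] :
    ∃ v : H, dr * v = 1 ∧ v * dr = 1 := by
  have hS := hΛ.antipode_bijective
  let J : Ideal H :=
    { carrier := {a | S a * dr = 0}
      add_mem' := fun {a b} ha hb => by
        change S (a + b) * dr = 0
        rw [map_add, add_mul, show S a * dr = 0 from ha, show S b * dr = 0 from hb, add_zero]
      zero_mem' := by
        change S 0 * dr = 0
        rw [map_zero, zero_mul]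
      smul_mem' := fun c a ha => by
        change S (c * a) * dr = 0
        obtain ⟨c, rfl⟩ := hS.2 c
        rw [HopfAlgebra.antipode_mul_antidistrib, mul_assoc, ← drinfeldElement_mul hΛ, ← mul_assoc,
          show S a * dr = 0 from ha, zero_mul] }
  obtain ⟨e, he, hspan⟩ := IsSemisimpleRing.ideal_eq_span_idempotent J
  have heJ : S e * dr = 0 := by
    have : e ∈ J := by rw [hspan]; exact Ideal.mem_span_singleton_self e
    exact this
  have htr : LinearMap.trace k H (LinearMap.mulRight k e) = 0 := by
    rw [trace_mulRight hΛ, heJ, map_zero]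
  have hid : IsIdempotentElem (LinearMap.mulRight k e) := by
    ext x
    simp [mul_assoc, he.eq]
  have he0 : e = 0 := by
    have := LinearMap.congr_fun ((LinearMap.IsIdempotentElem.trace_eq_zero_iff hid).1 htr) 1
    simpa using this
  have hinj : Function.Injective (LinearMap.mulRight k dr) := by
    rw [injective_iff_map_eq_zero]
    intro a ha
    obtain ⟨a, rfl⟩ := hS.2 a
    have : a ∈ J := ha
    rw [hspan, he0, Ideal.mem_span_singleton'] at this
    obtain ⟨b, hb⟩ := this
    rw [← hb, mul_zero, map_zero]
  obtain ⟨v, hv⟩ := LinearMap.injective_iff_surjective.1 hinj 1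
  have hv' : v * dr = 1 := hv
  refine ⟨v, hinj ?_, hv'⟩
  simp [mul_assoc, hv']

end Traces

/-! ### The regular character -/

section RegularCharacter

theorem exists_trace_eq_natCast {k V : Type*} [Field k] [AddCommGroup V] [Module k V]
    [FiniteDimensional k V] {e : Module.End k V} (he : e * e = e) :
    ∃ r : ℕ, LinearMap.trace k V e = r :=
  ⟨_, (LinearMap.IsIdempotentElem.isProj_range e he).trace⟩

/-- An involution whose trace is a nonzero integral multiple of the dimension is `± 1`. -/
theorem eq_one_of_trace_eq_trace_mul {k V : Type*} [Field k] [CharZero k] [AddCommGroup V]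
    [Module k V] [FiniteDimensional k V] {P Q : Module.End k V} {n : ℕ} (hn : n ≠ 0)
    (hdim : Module.finrank k V = n) (hQ : Q * Q = 1) (hP : P * P = (n : k) • P)
    (hPQ : P * Q = Q * P) (htr : LinearMap.trace k V (Q * P) = LinearMap.trace k V Q)
    (hne : LinearMap.trace k V Q ≠ 0) {x : V} (hx : x ≠ 0) (hQx : Q x = x) : Q = 1 := by
  have hn' : (n : k) ≠ 0 := Nat.cast_ne_zero.2 hn
  have hQQ : ∀ X : Module.End k V, Q * (Q * X) = X := fun X => by rw [← mul_assoc, hQ, one_mul]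
  have hPQ' : ∀ X : Module.End k V, P * (Q * X) = Q * (P * X) := fun X => by
    rw [← mul_assoc, hPQ, mul_assoc]
  have h2n : (2 * n : k) ≠ 0 := mul_ne_zero two_ne_zero hn'
  -- The projection P/n commutes with Q, so its products with the eigenprojections (1 ± Q)/2 are
  -- projections of integral ranks r₁, r₂, and Tr Q = Tr QP = n(r₁ − r₂).
  obtain ⟨r₁, hr₁⟩ := exists_trace_eq_natCast (e := (2 * n : k)⁻¹ • (P + Q * P)) (by
    rw [smul_mul_smul_comm, mul_add, add_mul, add_mul, mul_assoc, mul_assoc, hPQ', hQQ, hP,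
      mul_smul, inv_smul_eq_iff₀ h2n, mul_smul_comm]
    module)
  obtain ⟨r₂, hr₂⟩ := exists_trace_eq_natCast (e := (2 * n : k)⁻¹ • (P - Q * P)) (by
    rw [smul_mul_smul_comm, mul_sub, sub_mul, sub_mul, mul_assoc, mul_assoc, hPQ', hQQ, hP,
      mul_smul, inv_smul_eq_iff₀ h2n, mul_smul_comm]
    module)
  have h₁ : ((2 : k)⁻¹ • (1 + Q)) * ((2 : k)⁻¹ • (1 + Q)) = (2 : k)⁻¹ • (1 + Q) := by
    rw [smul_mul_smul_comm, mul_add, add_mul, add_mul, hQ, mul_smul,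
      inv_smul_eq_iff₀ two_ne_zero, mul_one, one_mul]
    module
  have h₂ : ((2 : k)⁻¹ • (1 - Q)) * ((2 : k)⁻¹ • (1 - Q)) = (2 : k)⁻¹ • (1 - Q) := by
    rw [smul_mul_smul_comm, mul_sub, sub_mul, sub_mul, hQ, mul_smul,
      inv_smul_eq_iff₀ two_ne_zero, mul_one, one_mul]
    module
  obtain ⟨p, hp⟩ := exists_trace_eq_natCast h₁
  obtain ⟨q, hq⟩ := exists_trace_eq_natCast h₂
  have hp0 : p ≠ 0 := by
    rintro rfl
    rw [Nat.cast_zero] at hp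
    have h := LinearMap.congr_fun ((LinearMap.IsIdempotentElem.trace_eq_zero_iff h₁).1 hp) x
    simp only [LinearMap.smul_apply, LinearMap.add_apply, Module.End.one_apply, hQx,
      LinearMap.zero_apply] at h
    apply hx
    rw [← h]
    module
  simp only [map_smul, map_add, map_sub, LinearMap.trace_one, hdim, htr, smul_eq_mul] at hr₁ hr₂ hp hq htr
  have e₁ : (p : k) + q = n := by rw [← hp, ← hq]; ring
  have e₂ : LinearMap.trace k V Q = p - q := by rw [← hp, ← hq]; ring
  have e₃ : LinearMap.trace k V Q = n * (r₁ - r₂) := by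
    rw [← hr₁, ← hr₂]; field_simp; ring
  have e₄ : ((p : ℤ) + q) * (r₁ - r₂) = p - q := by
    have : (((p : ℤ) + q) * (r₁ - r₂) : k) = p - q := by
      push_cast
      rw [e₁, ← e₃, e₂]
    exact_mod_cast this
  have e₅ : (p : ℤ) - q ≠ 0 := by
    intro h
    apply hne
    rw [e₂]
    exact_mod_cast congrArg (Int.cast : ℤ → k) h
  -- Here p and q are the multiplicities of the eigenvalues 1 and −1. As p − q is a nonzero multiple
  -- of p + q, one of them vanishes; the fixed vector x rules out p = 0.
  have hq0 : q = 0 := by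
    by_contra hq0
    have hp1 : (1 : ℤ) ≤ p := by omega
    have hq1 : (1 : ℤ) ≤ q := by omega
    rcases lt_trichotomy ((r₁ : ℤ) - r₂) 0 with h | h | h
    · nlinarith
    · rw [h, mul_zero] at e₄
      exact e₅ e₄.symm
    · nlinarith
  rw [hq0, Nat.cast_zero] at hq
  have h := (LinearMap.IsIdempotentElem.trace_eq_zero_iff h₂).1 (by
    rw [map_smul, map_sub, LinearMap.trace_one, hdim, smul_eq_mul, hq])
  rw [smul_eq_zero_iff_right (inv_ne_zero two_ne_zero), sub_eq_zero] at h
  exact h.symm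

variable {k : Type*} {H : Type*} [Field k] [Ring H] [HopfAlgebra k H]

variable (k H) in
/-- The character of the regular representation. -/
def regularCharacter : HopfDual k H :=
  (toForm k H).symm (LinearMap.trace k H ∘ₗ (Algebra.lmul k H).toLinearMap)

theorem toForm_regularCharacter (h : H) :
    toForm k H (regularCharacter k H) h = LinearMap.trace k H (Algebra.lmul k H h) := rfl

variable [FiniteDimensional k H]

theorem trace_lmul_tensor (t : H ⊗[k] H) :
    LinearMap.trace k (H ⊗[k] H) (Algebra.lmul k (H ⊗[k] H) t) =
      pair₂ k H (regularCharacter k H ⊗ₜ regularCharacter k H) t := by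
  induction t with
  | zero => simp
  | add t t' ht ht' => simp only [map_add, ht, ht']
  | tmul a b =>
    rw [pair₂_tmul, toForm_regularCharacter, toForm_regularCharacter,
      ← LinearMap.trace_tensorProduct']
    congr 1
    ext x y
    simp

/-- The Galois map α(a ⊗ b) = Δ(a)(1 ⊗ b) is an isomorphism from H ⊗ H with H acting on the first
factor onto H ⊗ H with the diagonal action, so the diagonal representation is dim H copies of the
regular one. -/
theorem regularCharacter_mul_self :
    regularCharacter k H * regularCharacter k H =
      (Module.finrank k H : k) • regularCharacter k H := by
  let α : H ⊗[k] H →ₗ[k] H ⊗[k] H := LinearMap.mul' k (H ⊗[k] H) ∘ₗ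
    TensorProduct.map Coalgebra.comul (TensorProduct.mk k H H 1)
  have hα : ∀ a b, α (a ⊗ₜ b) = Coalgebra.comul (R := k) a * (1 ⊗ₜ b) := fun a b => by simp [α]
  have hs : Function.Surjective α := by
    rw [← LinearMap.range_eq_top, eq_top_iff, ← TensorProduct.span_tmul_eq_top,
      Submodule.span_le]
    rintro _ ⟨h, b, rfl⟩
    have r := Coalgebra.Repr.arbitrary k h
    refine ⟨∑ i ∈ r.index, r.left i ⊗ₜ (HopfAlgebra.antipode k (r.right i) * b), ?_⟩
    have h1 : ∀ i, ((1 : H) ⊗ₜ[k] (HopfAlgebra.antipode k (r.right i) * b)) =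
        (1 ⊗ₜ HopfAlgebra.antipode k (r.right i)) * (1 ⊗ₜ b) := fun i => by simp
    simp only [map_sum, hα, h1, ← mul_assoc]
    rw [← Finset.sum_mul, sum_comul_mul_antipode]
    simp
  let e := LinearEquiv.ofBijective α ⟨LinearMap.injective_iff_surjective.2 hs, hs⟩
  refine dual_ext fun h => ?_
  have h1 : Algebra.lmul k (H ⊗[k] H) (Coalgebra.comul h) =
      e.conj (Algebra.lmul k (H ⊗[k] H) (h ⊗ₜ 1)) := by
    have h2 : ∀ y, e ((h ⊗ₜ 1) * y) = Coalgebra.comul (R := k) h * e y := by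
      intro y
      change α _ = _ * α y
      induction y with
      | zero => simp
      | add y y' hy hy' => simp only [mul_add, map_add, hy, hy']
      | tmul a b => simp [hα, mul_assoc]
    refine LinearMap.ext fun x => ?_
    simp [LinearEquiv.conj_apply, h2]
  rw [← pair₂_comul, ← trace_lmul_tensor, h1, LinearMap.trace_conj', trace_lmul_tensor,
    pair₂_tmul, toForm_regularCharacter 1, map_one, LinearMap.trace_one]
  simp [mul_comm]

/-- S² is conjugation by `drinfeldElement`, and a trace is invariant under conjugation. -/
theorem antipode_antipode_regularCharacter [CharZero k] [IsSemisimpleRing H] {Λ : H}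
    (hΛ : IsNormalizedIntegral k Λ) :
    HopfAlgebra.antipode k (HopfAlgebra.antipode k (regularCharacter k H)) =
      regularCharacter k H := by
  obtain ⟨v, hv, hv'⟩ := exists_inverse_drinfeldElement hΛ
  refine dual_ext fun h => ?_
  change toForm k H (regularCharacter k H)
    (HopfAlgebra.antipode k (HopfAlgebra.antipode k h)) = _
  have h1 : HopfAlgebra.antipode k (HopfAlgebra.antipode k h) = drinfeldElement k Λ * h * v := by
    rw [drinfeldElement_mul hΛ, mul_assoc, hv, mul_one]
  rw [h1, toForm_regularCharacter, map_mul, LinearMap.trace_mul_comm, ← map_mul, ← mul_assoc, hv',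
    one_mul, toForm_regularCharacter]

theorem toForm_regularCharacter_integral {Λ : H} (hΛ : IsNormalizedIntegral k Λ) :
    toForm k H (regularCharacter k H) Λ = 1 := by
  have h : Algebra.lmul k H Λ = LinearMap.smulRight (Coalgebra.counit (R := k)) Λ := by
    ext x
    simp [hΛ.mul_right]
  rw [toForm_regularCharacter, h, LinearMap.trace_smulRight, hΛ.counit_eq]

end RegularCharacter

/-! ### The theorem of Larson and Radford -/

section LarsonRadford

variable {H : Type*} [Ring H] [HopfAlgebra ℂ H] [FiniteDimensional ℂ H] {Λ : H}
  (hΛ : IsNormalizedIntegral ℂ Λ)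

local notation "S" => HopfAlgebra.antipode ℂ (A := H)

/-- Iterated Radford formula. When the j-th power of the modular element is 1, S^{4j} is the
identity, so the 2j-th power of `drinfeldElement` is central. -/
theorem iterate_antipode_sq_mul_modularElement_pow (j : ℕ) (x : H) :
    (fun y => S (S y))^[2 * j] x * modularElement hΛ ^ j = modularElement hΛ ^ j * x := by
  induction j generalizing x with
  | zero => simp
  | succ j ih =>
    rw [mul_add, mul_one, Function.iterate_succ_apply, Function.iterate_succ_apply, pow_succ,
      ← mul_assoc, ih, mul_assoc, antipode_pow_four hΛ, ← mul_assoc]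

include hΛ in
theorem iterate_antipode_sq_mul_drinfeldElement_pow (j : ℕ) (x : H) :
    drinfeldElement ℂ Λ ^ j * x = (fun y => S (S y))^[j] x * drinfeldElement ℂ Λ ^ j := by
  induction j generalizing x with
  | zero => simp
  | succ j ih =>
    rw [pow_succ, mul_assoc, drinfeldElement_mul hΛ, ← mul_assoc, ih, Function.iterate_succ_apply,
      mul_assoc]

variable [IsSemisimpleRing H]

include hΛ in
theorem toForm_dualIntegral_one_ne_zero : toForm ℂ H (dualIntegral hΛ) 1 ≠ 0 := by
  obtain ⟨v, hv, hv'⟩ := exists_inverse_drinfeldElement hΛ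
  obtain ⟨m, hm, hg⟩ := exists_modularElement_pow_eq_one hΛ
  have hS : S ∘ₗ S =
      LinearMap.mulLeft ℂ (drinfeldElement ℂ Λ) ∘ₗ LinearMap.mulRight ℂ v := by
    ext h
    change S (S h) = drinfeldElement ℂ Λ * (h * v)
    rw [← mul_assoc, drinfeldElement_mul hΛ, mul_assoc, hv, mul_one]
  rw [← trace_antipode_sq hΛ, hS]
  -- The central element is Λ: with u the Drinfeld element, uΛ = ε(u)Λ has regular trace ε(u),
  -- nonzero because u is invertible.
  refine trace_conj_ne_zero (z := Λ) (N := 2 * m) (by omega) hv hv' (fun x => ?_) (fun x => ?_) ?_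
  · have := iterate_antipode_sq_mul_modularElement_pow hΛ m x
    rw [hg, mul_one, one_mul] at this
    rw [iterate_antipode_sq_mul_drinfeldElement_pow hΛ, this]
  · rw [hΛ.mul_left, hΛ.mul_right]
  · have hε : Coalgebra.counit (R := ℂ) (drinfeldElement ℂ Λ) ≠ 0 := fun h => by
      have := congrArg (Coalgebra.counit (R := ℂ)) hv
      simp [h] at this
    have : LinearMap.trace ℂ H (LinearMap.mulLeft ℂ Λ) = 1 := toForm_regularCharacter_integral hΛ
    have h1 : LinearMap.mulLeft ℂ (Coalgebra.counit (R := ℂ) (drinfeldElement ℂ Λ) • Λ) =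
        Coalgebra.counit (R := ℂ) (drinfeldElement ℂ Λ) • LinearMap.mulLeft ℂ Λ := by
      ext x
      simp
    rwa [hΛ.mul_left, h1, map_smul, this, smul_eq_mul, mul_one]

/-- Evaluate f * λ = f(g)λ at 1, with g the modular element, and cancel λ(1) ≠ 0. -/
theorem modularElement_eq_one : modularElement hΛ = 1 :=
  toForm_separating (k := ℂ) fun f => by
    have h1 := LinearMap.congr_fun (congrArg (toForm ℂ H) (mul_dualIntegral hΛ f)) 1
    rw [toForm_mul, Bialgebra.comul_one, Algebra.TensorProduct.one_def, TensorProduct.map_tmul,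
      LinearMap.mul'_apply, map_smul, LinearMap.smul_apply, smul_eq_mul] at h1
    exact (mul_right_cancel₀ (toForm_dualIntegral_one_ne_zero hΛ) h1).symm

theorem mul_dualIntegral_of_isSemisimpleRing (f : HopfDual ℂ H) :
    f * dualIntegral hΛ = toForm ℂ H f 1 • dualIntegral hΛ := by
  rw [mul_dualIntegral, modularElement_eq_one]

include hΛ in
theorem antipode_pow_four_eq_one : (S ∘ₗ S) * (S ∘ₗ S) = 1 := by
  ext h
  have := antipode_pow_four hΛ h
  rwa [modularElement_eq_one, mul_one, one_mul] at this

include hΛ in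
theorem antipode_antipode_of_isNormalizedIntegral (h : H) : S (S h) = h := by
  -- P(x) = x₁χ(x₂), with χ the regular character, is the transpose of right multiplication by χ.
  -- Then P² = (dim H) P follows from χ² = (dim H) χ, and Tr(S²P) = λ(1)χ(Λ) = λ(1) = Tr(S²).
  let P : Module.End ℂ H := (TensorProduct.rid ℂ H).toLinearMap ∘ₗ
    (toForm ℂ H (regularCharacter ℂ H)).lTensor H ∘ₗ Coalgebra.comul
  have hP : ∀ (f : HopfDual ℂ H) (x : H),
      toForm ℂ H f (P x) = toForm ℂ H (f * regularCharacter ℂ H) x :=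
    fun f x => toForm_contractSnd _ f x
  have : Nontrivial H := (Bialgebra.counitAlgHom ℂ H).toRingHom.domain_nontrivial
  have key : S ∘ₗ S = (1 : Module.End ℂ H) := by
    refine eq_one_of_trace_eq_trace_mul (P := P) (Module.finrank_pos (R := ℂ) (M := H)).ne' rfl
      (antipode_pow_four_eq_one hΛ) ?_ ?_ ?_ ?_ (one_ne_zero (α := H)) (by simp)
    · ext x
      refine toForm_separating (k := ℂ) fun f => ?_
      rw [Module.End.mul_apply, hP, hP, mul_assoc, regularCharacter_mul_self]
      simp [hP]
    · ext x
      refine toForm_separating (k := ℂ) fun f => ?_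
      have h1 : ∀ (f : HopfDual ℂ H) (y : H), toForm ℂ H f (S y) =
        toForm ℂ H (HopfAlgebra.antipode ℂ f) y := fun _ _ => rfl
      rw [Module.End.mul_apply, Module.End.mul_apply, hP, LinearMap.comp_apply,
        LinearMap.comp_apply, h1, h1, h1, h1, hP, HopfAlgebra.antipode_mul_antidistrib,
        HopfAlgebra.antipode_mul_antidistrib, antipode_antipode_regularCharacter hΛ]
    · rw [trace_antipode_sq hΛ, trace_antipode_sq_comp_contractSnd hΛ (regularCharacter ℂ H) _
        fun _ => rfl, toForm_regularCharacter_integral hΛ, mul_one]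
    · rw [trace_antipode_sq hΛ]
      exact toForm_dualIntegral_one_ne_zero hΛ
  exact LinearMap.congr_fun key h

end LarsonRadford

/-- **Larson–Radford**: the antipode of a semisimple complex Hopf algebra is an involution. -/
theorem antipode_antipode_of_isSemisimpleRing {H : Type*} [Ring H] [HopfAlgebra ℂ H]
    [FiniteDimensional ℂ H] [IsSemisimpleRing H] (h : H) :
    HopfAlgebra.antipode ℂ (HopfAlgebra.antipode ℂ h) = h := by
  obtain ⟨Λ, hΛ⟩ := exists_isNormalizedIntegral ℂ H
  exact antipode_antipode_of_isNormalizedIntegral hΛ h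

/-- **Maschke's theorem** for Hopf algebras. -/
theorem IsNormalizedIntegral.isSemisimpleRing {k H : Type*} [Field k] [Ring H] [HopfAlgebra k H]
    [FiniteDimensional k H] {Λ : H} (hΛ : IsNormalizedIntegral k Λ) : IsSemisimpleRing H := by
  refine (isSemisimpleModule_iff H H).2 ⟨fun N => ?_⟩
  obtain ⟨π, hπ⟩ := (N.restrictScalars k).subtype.exists_leftInverse_of_injective
    (Submodule.ker_subtype _)
  have hπ' : ∀ n : N, π n = n := fun n => LinearMap.congr_fun hπ n
  -- A linear projection π onto N is averaged to x ↦ Λ₁π(S(Λ₂)x); moving factors across Δ(Λ) makes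
  -- it H-linear.
  let Φ : H → H ⊗[k] H →ₗ[k] N.restrictScalars k := fun x =>
    TensorProduct.lift (LinearMap.mk₂ k
      (fun a b => (⟨a * π (HopfAlgebra.antipode k b * x),
        N.smul_mem a (π (HopfAlgebra.antipode k b * x)).2⟩ : N.restrictScalars k))
      (fun a a' b => Subtype.ext (add_mul _ _ _))
      (fun c a b => Subtype.ext (smul_mul_assoc _ _ _))
      (fun a b b' => Subtype.ext (by simp [add_mul, mul_add]))
      (fun c a b => Subtype.ext (by simp)))
  have hΦ : ∀ x a b, (Φ x (a ⊗ₜ b) : H) = a * π (HopfAlgebra.antipode k b * x) :=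
    fun x a b => rfl
  have hΦl : ∀ c x t, (Φ x ((c ⊗ₜ 1) * t) : H) = c * Φ x t := by
    intro c x t
    induction t with
    | zero => simp
    | add t t' ht ht' => simp only [mul_add, map_add, Submodule.coe_add, ht, ht']
    | tmul a b => simp [hΦ, mul_assoc]
  have hΦr : ∀ c x t, Φ x ((1 ⊗ₜ c) * t) = Φ (HopfAlgebra.antipode k c * x) t := by
    intro c x t
    induction t with
    | zero => simp
    | add t t' ht ht' => simp only [mul_add, map_add, ht, ht']
    | tmul a b =>
      apply Subtype.ext
      simp [hΦ, HopfAlgebra.antipode_mul_antidistrib, mul_assoc]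
  let p : H →ₗ[H] N :=
    { toFun := fun x => Φ x (Coalgebra.comul Λ)
      map_add' := fun x y => by
        have : ∀ t, Φ (x + y) t = Φ x t + Φ y t := by
          intro t
          induction t with
          | zero => simp
          | add t t' ht ht' => simp only [map_add, ht, ht']; abel
          | tmul a b =>
            apply Subtype.ext
            simp [hΦ, mul_add]
        exact this _
      map_smul' := fun c x => by
        obtain ⟨c, rfl⟩ := hΛ.antipode_bijective.2 c
        apply Subtype.ext
        change (Φ (HopfAlgebra.antipode k c * x) (Coalgebra.comul Λ) : H) =
          HopfAlgebra.antipode k c * Φ x (Coalgebra.comul Λ)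
        rw [← hΦr, ← hΦl, hΛ.tmul_one_mul_comul] }
  refine ⟨LinearMap.ker p, LinearMap.isCompl_of_proj fun n => Subtype.ext ?_⟩
  change (Φ n (Coalgebra.comul Λ) : H) = n
  have h1 : ∀ t, (Φ n t : H) =
      LinearMap.mul' k H (LinearMap.lTensor H (HopfAlgebra.antipode k) t) * n := by
    intro t
    induction t with
    | zero => simp
    | add t t' ht ht' => simp only [map_add, Submodule.coe_add, ht, ht', add_mul]
    | tmul a b =>
      have h2 : (π (HopfAlgebra.antipode k b * n) : H) = HopfAlgebra.antipode k b * n :=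
        congrArg Subtype.val (hπ' ⟨_, N.smul_mem (HopfAlgebra.antipode k b) n.2⟩)
      rw [hΦ, h2]
      simp [mul_assoc]
  rw [h1, HopfAlgebra.mul_antipode_lTensor_comul_apply, hΛ.counit_eq, map_one, one_mul]

/-- The normalized integral of the dual Hopf algebra. -/
theorem isNormalizedIntegral_dual {H : Type*} [Ring H] [HopfAlgebra ℂ H] [FiniteDimensional ℂ H]
    [IsSemisimpleRing H] {Λ : H} (hΛ : IsNormalizedIntegral ℂ Λ) :
    IsNormalizedIntegral ℂ ((toForm ℂ H (dualIntegral hΛ) 1)⁻¹ • dualIntegral hΛ) where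
  mul_left f := by
    rw [mul_smul_comm, mul_dualIntegral_of_isSemisimpleRing, smul_comm]
    rfl
  mul_right f := by
    rw [smul_mul_assoc, dualIntegral_mul, smul_comm]
    rfl
  counit_eq := by
    rw [map_smul, smul_eq_mul]
    exact inv_mul_cancel₀ (toForm_dualIntegral_one_ne_zero hΛ)

theorem isSemisimpleRing_hopfDual (H : Type*) [Ring H] [HopfAlgebra ℂ H] [FiniteDimensional ℂ H]
    [IsSemisimpleRing H] : IsSemisimpleRing (HopfDual ℂ H) := by
  obtain ⟨Λ, hΛ⟩ := exists_isNormalizedIntegral ℂ H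
  exact (isNormalizedIntegral_dual hΛ).isSemisimpleRing

/-! ### Regular characters of a semisimple Hopf algebra and of its dual -/

section

variable {H : Type*} [Ring H] [HopfAlgebra ℂ H] [FiniteDimensional ℂ H] [IsSemisimpleRing H]
  {Λ : H} (hΛ : IsNormalizedIntegral ℂ Λ)

/-- This is S(Λ) = Λ applied to the normalized integral of H^*. -/
theorem toForm_dualIntegral_antipode (h : H) :
    toForm ℂ H (dualIntegral hΛ) (HopfAlgebra.antipode ℂ h) = toForm ℂ H (dualIntegral hΛ) h := by
  have h1 := (isNormalizedIntegral_dual hΛ).antipode_eq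
  have h2 := LinearMap.congr_fun (congrArg (toForm ℂ H) h1) h
  rw [map_smul, map_smul, map_smul] at h2
  exact mul_left_cancel₀ (inv_ne_zero (toForm_dualIntegral_one_ne_zero hΛ)) h2

/-- As S² = 1, λ is a trace form, so the trace formula gives λ(S(Λ₂)S(h)Λ₁) = λ(S(h)Λ₁S(Λ₂)) =
λ(S(h)) = λ(h). -/
theorem regularCharacter_eq_dualIntegral : regularCharacter ℂ H = dualIntegral hΛ := by
  have r := Coalgebra.Repr.arbitrary ℂ Λ
  refine dual_ext fun h => ?_
  rw [toForm_regularCharacter, trace_eq_sum hΛ _ r, ← toForm_dualIntegral_antipode]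
  simp only [HopfAlgebra.antipode_mul_antidistrib, Algebra.coe_lmul_eq_mul, LinearMap.mul_apply']
  have h2 : ∀ i ∈ r.index, toForm ℂ H (dualIntegral hΛ) (HopfAlgebra.antipode ℂ (r.right i) *
      HopfAlgebra.antipode ℂ h * r.left i) = toForm ℂ H (dualIntegral hΛ)
        (HopfAlgebra.antipode ℂ h * (r.left i * HopfAlgebra.antipode ℂ (r.right i))) := by
    intro i _
    rw [← mul_assoc, toForm_dualIntegral_mul_comm hΛ (HopfAlgebra.antipode ℂ h * r.left i),
      antipode_antipode_of_isSemisimpleRing, mul_assoc]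
  rw [Finset.sum_congr rfl h2, ← map_sum, ← Finset.mul_sum,
    HopfAlgebra.sum_mul_antipode_eq_algebraMap_counit, hΛ.counit_eq, map_one, mul_one]

/-- The antipode of H^* conjugates left multiplication by f into right multiplication by S(f), the
transpose of x ↦ x₁S(f)(x₂), whose trace is already known. -/
theorem toForm_regularCharacter_dual (f : HopfDual ℂ H) :
    toForm ℂ (HopfDual ℂ H) (regularCharacter ℂ (HopfDual ℂ H)) f =
      toForm ℂ H (dualIntegral hΛ) 1 * toForm ℂ H f Λ := by
  let P : Module.End ℂ H := (TensorProduct.rid ℂ H).toLinearMap ∘ₗ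
    (toForm ℂ H (HopfAlgebra.antipode ℂ f)).lTensor H ∘ₗ Coalgebra.comul
  have hP : LinearMap.trace ℂ H P = toForm ℂ H (dualIntegral hΛ) 1 * toForm ℂ H f Λ := by
    rw [trace_antipode_sq_comp_contractSnd hΛ (HopfAlgebra.antipode ℂ f) P
      fun h => by rw [antipode_antipode_of_isSemisimpleRing]; rfl]
    congr 1
    change toForm ℂ H f (HopfAlgebra.antipode ℂ Λ) = _
    rw [hΛ.antipode_eq]
  let σ := LinearEquiv.ofBijective (HopfAlgebra.antipode ℂ (A := HopfDual ℂ H))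
    (isNormalizedIntegral_dual hΛ).antipode_bijective
  let e := σ.trans (toForm ℂ H)
  rw [toForm_regularCharacter, ← hP, ← LinearMap.trace_transpose' P, ← LinearMap.trace_conj' _ e]
  congr 1
  refine LinearMap.ext fun φ => ?_
  obtain ⟨g, rfl⟩ := e.surjective φ
  rw [LinearEquiv.conj_apply]
  simp only [LinearMap.comp_apply, LinearEquiv.coe_coe, LinearEquiv.symm_apply_apply]
  change toForm ℂ H (HopfAlgebra.antipode ℂ (f * g)) =
    Module.Dual.transpose P (toForm ℂ H (HopfAlgebra.antipode ℂ g))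
  rw [HopfAlgebra.antipode_mul_antidistrib]
  exact LinearMap.ext fun h => (toForm_contractSnd _ _ h).symm

end

/-! ### The canonical pivotal structure -/

section Pivotal

open HopfRep

variable {k : Type} {H : Type u} [Field k] [Ring H] [HopfAlgebra k H]

/-- The pivotal structure given by the canonical isomorphisms `V ≅ V^{**}` of vector spaces, when
the antipode is an involution. -/
def evalPivotal (hS : ∀ h : H, HopfAlgebra.antipode k (HopfAlgebra.antipode k h) = h) :
    PivotalStructure k H where
  j X := ⟨Module.evalEquiv k X.V, fun h v => LinearMap.ext fun f => by
    simp [hS]⟩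
  natural f := Subtype.ext <| LinearMap.ext fun x => LinearMap.ext fun φ => rfl
  monoidal X Y x y f g := by simp
  monoidal_unit c f := rfl

theorem catTrace_eq_trace {X : HopfRep k H} (f : Hom X X.dual.dual) :
    catTrace f = LinearMap.trace k X.V ((Module.evalEquiv k X.V).symm.toLinearMap ∘ₗ f.1) := by
  classical
  have h1 : catTrace f = contractLeft k (Module.Dual k X.V)
      (TensorProduct.map f.1 LinearMap.id (coevaluation k X.V 1)) := rfl
  rw [h1, coevaluation_apply_one,
    LinearMap.trace_eq_matrix_trace k (Module.Basis.ofVectorSpace k X.V)]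
  simp only [map_sum, TensorProduct.map_tmul, contractLeft_apply, LinearMap.id_apply,
    Matrix.trace, Matrix.diag, LinearMap.toMatrix_apply]
  refine Finset.sum_congr rfl fun i _ => ?_
  obtain ⟨x, hx⟩ := (Module.evalEquiv k X.V).surjective (f.1 (Module.Basis.ofVectorSpace k X.V i))
  rw [LinearMap.comp_apply, ← hx, LinearEquiv.coe_coe, LinearEquiv.symm_apply_apply]
  rfl

theorem evalPivotal_isCanonical
    (hS : ∀ h : H, HopfAlgebra.antipode k (HopfAlgebra.antipode k h) = h) :
    (evalPivotal hS).IsCanonical := fun X => by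
  rw [PivotalStructure.ptr, catTrace_eq_trace, ← LinearMap.trace_id k X.V]
  congr 1
  ext x
  exact (Module.evalEquiv k X.V).symm_apply_apply x

variable [FiniteDimensional k H]

/-- A left ideal as a representation. -/
def idealRep (N : Ideal H) : HopfRep k H :=
  haveI : FiniteDimensional k N :=
    inferInstanceAs (FiniteDimensional k (N.restrictScalars k))
  { V := N
    ρ := Algebra.lsmul k k N }

/-- The element of `H` which describes a pivotal structure. -/
def pivotalElement (P : PivotalStructure k H) : H :=
  (Module.evalEquiv k H).symm ((P.j (regular k H)).toEquiv (1 : H))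

/-- Naturality along the morphism h ↦ hx from the regular representation reduces j_X to its value at
1 ∈ H. -/
theorem pivotal_apply (P : PivotalStructure k H) (X : HopfRep k H) (x : X.V)
    (f : Module.Dual k X.V) : (P.j X).toEquiv x f = f (X.ρ (pivotalElement P) x) := by
  let r : Hom (regular k H) X := ⟨X.ρ.toLinearMap.flip x, fun h (v : H) => by
    change X.ρ (h * v) x = X.ρ h (X.ρ v x)
    rw [map_mul, Module.End.mul_apply]⟩
  have h1 := LinearMap.congr_fun (LinearMap.congr_fun (congrArg Subtype.val (P.natural r)) (1 : H)) f
  have h2 : (P.j X).toEquiv (X.ρ 1 x) f =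
      (P.j (regular k H)).toEquiv (1 : H) (f ∘ₗ X.ρ.toLinearMap.flip x) := h1
  rw [map_one, Module.End.one_apply] at h2
  have h3 : (P.j (regular k H)).toEquiv (1 : H) = Module.evalEquiv k H (pivotalElement P) :=
    ((Module.evalEquiv k H).apply_symm_apply _).symm
  rw [h2, h3]
  rfl

/-- Equivariance of j on the regular representation; H acts on the double dual through S² = 1. -/
theorem pivotalElement_central
    (hS : ∀ h : H, HopfAlgebra.antipode k (HopfAlgebra.antipode k h) = h)
    (P : PivotalStructure k H) (h : H) : pivotalElement P * h = h * pivotalElement P := by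
  refine toForm_separating (k := k) fun f => ?_
  have h1 := LinearMap.congr_fun ((P.j (regular k H)).equivariant h (1 : H)) (toForm k H f)
  have h2 : toForm k H f (pivotalElement P * (h * 1)) = toForm k H f
      (HopfAlgebra.antipode k (HopfAlgebra.antipode k h) * (pivotalElement P * 1)) :=
    (pivotal_apply P (regular k H) (h * 1 : H) (toForm k H f)).symm.trans
      (h1.trans (pivotal_apply P (regular k H) (1 : H)
        (dualAction (Algebra.lmul k H) (HopfAlgebra.antipode k h) (toForm k H f))))
  rwa [hS, mul_one, mul_one] at h2

theorem trace_pivotalElement {P : PivotalStructure k H} (hP : P.IsCanonical) (X : HopfRep k H) :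
    LinearMap.trace k X.V (X.ρ (pivotalElement P)) = Module.finrank k X.V := by
  rw [← hP X, PivotalStructure.ptr, catTrace_eq_trace]
  congr 1
  refine LinearMap.ext fun x => (Module.evalEquiv k X.V).injective ?_
  rw [LinearMap.comp_apply, LinearEquiv.coe_coe, LinearEquiv.apply_symm_apply]
  exact LinearMap.ext fun f => (pivotal_apply P X x f).symm

/-- The eigenspaces N μ of the central element z are left ideals on which z has trace μ dim(N μ);
canonicity makes this dim(N μ), so only μ = 1 occurs. A nonzero complement of N 1 would contain a
further eigenvector. -/
theorem pivotalElement_eq_one [CharZero k] [IsAlgClosed k] [IsSemisimpleRing H]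
    (hS : ∀ h : H, HopfAlgebra.antipode k (HopfAlgebra.antipode k h) = h)
    {P : PivotalStructure k H} (hP : P.IsCanonical) : pivotalElement P = 1 := by
  set z := pivotalElement P with hz
  let N : k → Ideal H := fun μ =>
    { carrier := {h | z * h = μ • h}
      add_mem' := fun {a b} ha hb => by
        change z * (a + b) = μ • (a + b)
        rw [mul_add, smul_add, show z * a = μ • a from ha, show z * b = μ • b from hb]
      zero_mem' := by
        change z * 0 = μ • (0 : H)
        rw [mul_zero, smul_zero]
      smul_mem' := fun c a ha => by
        change z * (c * a) = μ • (c * a)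
        rw [← mul_assoc, pivotalElement_central hS, mul_assoc, show z * a = μ • a from ha,
          mul_smul_comm] }
  obtain ⟨N', hN'⟩ := exists_isCompl (N 1)
  have hN'bot : N' = ⊥ := by
    by_contra hne
    have : Nontrivial N' := Submodule.nontrivial_iff_ne_bot.2 hne
    have : FiniteDimensional k N' :=
      inferInstanceAs (FiniteDimensional k (N'.restrictScalars k))
    obtain ⟨μ, hμ⟩ := Module.End.exists_eigenvalue (Algebra.lsmul k k N' z)
    obtain ⟨y, hy⟩ := hμ.exists_hasEigenvector
    have hy1 : z * (y : H) = μ • (y : H) := congrArg Subtype.val hy.apply_eq_smul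
    have hyN : (y : H) ∈ N μ := hy1
    have hy0 : (y : H) ≠ 0 := fun h => hy.2 (Subtype.ext h)
    have htr : LinearMap.trace k (N μ) (Algebra.lsmul k k (N μ) z) =
        Module.finrank k (N μ) := trace_pivotalElement hP (idealRep (N μ))
    have : FiniteDimensional k (N μ) :=
      inferInstanceAs (FiniteDimensional k ((N μ).restrictScalars k))
    have : Nontrivial (N μ) := ⟨⟨⟨y, hyN⟩, 0, fun h => hy0 (congrArg Subtype.val h)⟩⟩
    have hsc : Algebra.lsmul k k (N μ) z = μ • (1 : Module.End k (N μ)) :=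
      LinearMap.ext fun x => Subtype.ext x.2
    rw [hsc, map_smul, LinearMap.trace_one, smul_eq_mul] at htr
    have hd : (Module.finrank k (N μ) : k) ≠ 0 :=
      Nat.cast_ne_zero.2 (Module.finrank_pos (R := k) (M := N μ)).ne'
    have hμ1 : μ = 1 := mul_right_cancel₀ hd (htr.trans (one_mul _).symm)
    subst hμ1
    have : (y : H) ∈ N 1 ⊓ N' := ⟨hyN, y.2⟩
    rw [hN'.inf_eq_bot] at this
    exact hy0 this
  have htop : N 1 = ⊤ := by simpa [hN'bot] using hN'.sup_eq_top
  have h1 : (1 : H) ∈ N 1 := htop ▸ Submodule.mem_top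
  have h2 : z * 1 = (1 : k) • (1 : H) := h1
  rwa [mul_one, one_smul] at h2

variable [CharZero k] [IsAlgClosed k] [IsSemisimpleRing H]
  (hS : ∀ h : H, HopfAlgebra.antipode k (HopfAlgebra.antipode k h) = h)

include hS in
theorem PivotalStructure.IsCanonical.toEquiv_eq {P : PivotalStructure k H} (hP : P.IsCanonical)
    (X : HopfRep k H) : (P.j X).toEquiv = Module.evalEquiv k X.V := by
  refine LinearEquiv.ext fun x => LinearMap.ext fun f => ?_
  rw [pivotal_apply, pivotalElement_eq_one hS hP, map_one]
  rfl

include hS in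
theorem existsUnique_isCanonical : ∃! P : PivotalStructure k H, P.IsCanonical := by
  refine ⟨evalPivotal hS, evalPivotal_isCanonical hS, fun P hP => ?_⟩
  have hj : P.j = (evalPivotal hS).j := by
    funext X
    have h1 := hP.toEquiv_eq hS X
    have h2 : ((evalPivotal hS).j X).toEquiv = Module.evalEquiv k X.V := rfl
    generalize P.j X = a at *
    generalize (evalPivotal hS).j X = b at *
    cases a
    cases b
    simp_all
  exact PivotalStructure.ext hj

end Pivotal

/-! ### Sweedler powers -/

section SweedlerPower

variable {k : Type*} {H : Type*} [Field k] [Ring H] [HopfAlgebra k H]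

variable (k) in
/-- The Sweedler power `h ↦ h₁ h₂ ⋯ hₙ`. -/
def sweedlerPower (n : ℕ) : H →ₗ[k] H :=
  ((WithConv.toConv LinearMap.id : WithConv (H →ₗ[k] H)) ^ n).ofConv

theorem sweedlerPower_zero (h : H) :
    sweedlerPower k 0 h = algebraMap k H (Coalgebra.counit (R := k) h) := by
  simp [sweedlerPower]

theorem sweedlerPower_succ (n : ℕ) (h : H) :
    sweedlerPower k (n + 1) h = LinearMap.mul' k H
      (TensorProduct.map LinearMap.id (sweedlerPower k n) (Coalgebra.comul h)) := by
  rw [sweedlerPower, pow_succ']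
  rfl

theorem sweedlerPower_succ_repr (n : ℕ) {ι : Type*} {h : H} (r : Coalgebra.Repr k h ι) :
    sweedlerPower k (n + 1) h =
      ∑ i ∈ r.index, r.left i * sweedlerPower k n (r.right i) := by
  rw [sweedlerPower_succ, ← r.eq]
  simp

/-- The product and coproduct of H^* are the transposes of the coproduct and product of H, so
Sweedler powers on both sides correspond. This is the symmetry that equates the indicators. -/
theorem toForm_sweedlerPower [FiniteDimensional k H] (n : ℕ) (f : HopfDual k H) (a : H) :
    toForm k H (sweedlerPower k n f) a = toForm k H f (sweedlerPower k n a) := by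
  induction n generalizing f a with
  | zero =>
    rw [sweedlerPower_zero, sweedlerPower_zero, Algebra.algebraMap_eq_smul_one,
      Algebra.algebraMap_eq_smul_one, map_smul, map_smul, LinearMap.smul_apply, toForm_one,
      smul_eq_mul, smul_eq_mul, mul_comm]
    rfl
  | succ n ih =>
    have h1 : ∀ t : HopfDual k H ⊗[k] HopfDual k H,
        toForm k H (LinearMap.mul' k _ (TensorProduct.map LinearMap.id (sweedlerPower k n) t)) a =
          pair₂ k H t (TensorProduct.map LinearMap.id (sweedlerPower k n)
            (Coalgebra.comul (R := k) a)) := by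
      intro t
      induction t with
      | zero => simp
      | add t t' ht ht' => simp only [map_add, LinearMap.add_apply, ht, ht']
      | tmul f g =>
        rw [TensorProduct.map_tmul, LinearMap.mul'_apply,
          toForm_mul_repr _ _ (Coalgebra.Repr.arbitrary k a),
          ← (Coalgebra.Repr.arbitrary k a).eq]
        simp [ih]
    rw [sweedlerPower_succ, h1]
    change pair₂ k H (dualComul k H f) _ = _
    rw [pair₂_dualComul_apply, sweedlerPower_succ]

end SweedlerPower

/-! ### Traces of cyclic permutations of tensor factors -/

section CyclicTrace

variable {k : Type*} [Field k] {V W : Type*} [AddCommGroup V] [Module k V] [FiniteDimensional k V]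
  [AddCommGroup W] [Module k W] [FiniteDimensional k W]

theorem trace_map_comp_comm (b c : Module.End k V) :
    LinearMap.trace k (V ⊗[k] V)
      (TensorProduct.map b c ∘ₗ (TensorProduct.comm k V V).toLinearMap) =
      LinearMap.trace k V (b ∘ₗ c) := by
  classical
  let B := Module.finBasis k V
  rw [LinearMap.trace_eq_matrix_trace k (B.tensorProduct B), LinearMap.trace_eq_matrix_trace k B,
    LinearMap.toMatrix_comp B B B]
  simp only [Matrix.trace, Matrix.diag, Matrix.mul_apply, LinearMap.toMatrix_apply]
  rw [Fintype.sum_prod_type]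
  refine Finset.sum_congr rfl fun x _ => Finset.sum_congr rfl fun y _ => ?_
  simp [mul_comm]

/-- Partial trace over one tensor factor; by linearity G is a pure tensor c ⊗ D, which reduces the
claim to Tr((b ⊗ c) ∘ flip) = Tr(bc). -/
theorem trace_map_comp_leftComm (b : Module.End k V) (G : Module.End k (V ⊗[k] W)) :
    LinearMap.trace k (V ⊗[k] (V ⊗[k] W))
      (TensorProduct.map b G ∘ₗ (TensorProduct.leftComm k V V W).toLinearMap) =
      LinearMap.trace k (V ⊗[k] W) (G ∘ₗ TensorProduct.map b LinearMap.id) := by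
  obtain ⟨t, rfl⟩ := (homTensorHomEquiv k V W V W).surjective G
  rw [homTensorHomEquiv_apply]
  induction t with
  | zero => simp
  | add t t' ht ht' =>
    simp only [map_add, TensorProduct.map_add_right, LinearMap.add_comp, ht, ht']
  | tmul c D =>
    rw [TensorProduct.homTensorHomMap_apply, ← TensorProduct.map_comp,
      LinearMap.trace_tensorProduct', LinearMap.trace_comp_comm' b c, ← trace_map_comp_comm b c,
      LinearMap.comp_id, ← LinearMap.trace_tensorProduct',
      ← LinearMap.trace_conj' _ (TensorProduct.assoc k V V W).symm]
    congr 1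
    ext x y w
    simp [LinearEquiv.conj_apply]

end CyclicTrace

/-! ### Cyclic rotations and the character formula for indicators -/

section CyclicRotation

open HopfRep

variable {k : Type} {H : Type u} [Field k] [Ring H] [HopfAlgebra k H]

theorem tensorAction_eq_sum {V W : Type*} [AddCommGroup V] [Module k V] [AddCommGroup W]
    [Module k W] (ρ : H →ₐ[k] Module.End k V) (σ : H →ₐ[k] Module.End k W)
    {ι : Type*} {h : H} (r : Coalgebra.Repr k h ι) :
    tensorAction ρ σ h = ∑ i ∈ r.index, TensorProduct.map (ρ (r.left i)) (σ (r.right i)) :=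
  TensorProduct.ext' fun v w => by
    rw [tensorAction_tmul ρ σ r]
    simp

/-- The cyclic rotation `x ⊗ w ↦ w ⊗ x` of `X ⊗ X^{⊗ m}`. -/
def rotation (X : HopfRep k H) (m : ℕ) : Module.End k (X.tensor (X.tpow m)).V :=
  (X.snoc m).1 ∘ₗ (TensorProduct.comm k X.V (X.tpow m).V).toLinearMap

theorem rotation_zero (X : HopfRep k H) : rotation X 0 = LinearMap.id := by
  refine TensorProduct.ext' fun x (c : ULift.{u} k) => ?_
  have h1 : lunit.{u} k X.V (c ⊗ₜ x) = runit.{u} k X.V (x ⊗ₜ c) := by simp [lunit, runit]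
  exact (LinearEquiv.symm_apply_eq _).2 h1

theorem rotation_succ (X : HopfRep k H) (m : ℕ) :
    rotation X (m + 1) = (rotation X m).lTensor X.V ∘ₗ
      (TensorProduct.leftComm k X.V X.V (X.tpow m).V).toLinearMap := by
  refine TensorProduct.ext (LinearMap.ext fun y => ?_)
  exact TensorProduct.ext' (M := X.V) (N := (X.tpow m).V) fun x w => rfl

theorem trace_comp_tensorAction {V W : Type*} [AddCommGroup V] [Module k V] [FiniteDimensional k V]
    [AddCommGroup W] [Module k W] [FiniteDimensional k W] (ρ : H →ₐ[k] Module.End k V)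
    (σ : H →ₐ[k] Module.End k W) (R : Module.End k (V ⊗[k] W)) (a : Module.End k V)
    {ι : Type*} {h : H} (r : Coalgebra.Repr k h ι) :
    LinearMap.trace k (V ⊗[k] (V ⊗[k] W)) ((R.lTensor V ∘ₗ
      (TensorProduct.leftComm k V V W).toLinearMap) ∘ₗ TensorProduct.map a (tensorAction ρ σ h)) =
      ∑ i ∈ r.index, LinearMap.trace k (V ⊗[k] W)
        (R ∘ₗ TensorProduct.map (a ∘ₗ ρ (r.left i)) (σ (r.right i))) := by
  have h1 : (R.lTensor V ∘ₗ (TensorProduct.leftComm k V V W).toLinearMap) ∘ₗ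
      TensorProduct.map a (tensorAction ρ σ h) = ∑ i ∈ r.index,
        TensorProduct.map (ρ (r.left i)) (R ∘ₗ TensorProduct.map a (σ (r.right i))) ∘ₗ
          (TensorProduct.leftComm k V V W).toLinearMap := by
    rw [tensorAction_eq_sum ρ σ r]
    ext y x w
    simp [TensorProduct.tmul_sum]
  rw [h1, map_sum]
  refine Finset.sum_congr rfl fun i _ => ?_
  rw [trace_map_comp_leftComm, LinearMap.comp_assoc, ← TensorProduct.map_comp, LinearMap.comp_id]

/-- Each induction step traces out one tensor factor, which composes the action of h₁ into a and
leaves h₂ for the remaining factors. -/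
theorem trace_rotation_comp_map (X : HopfRep k H) (m : ℕ) (a : Module.End k X.V) (h : H) :
    LinearMap.trace k _ (rotation X m ∘ₗ TensorProduct.map a ((X.tpow m).ρ h)) =
      LinearMap.trace k X.V (a ∘ₗ X.ρ (sweedlerPower k m h)) := by
  induction m generalizing a h with
  | zero =>
    have h1 : LinearMap.trace k (ULift.{u} k)
        (Coalgebra.counit (R := k) h • (1 : Module.End k (ULift.{u} k))) =
          Coalgebra.counit (R := k) h := by
      rw [map_smul, LinearMap.trace_one]
      simp
    rw [rotation_zero, LinearMap.id_comp]
    refine (LinearMap.trace_tensorProduct' a ((X.tpow 0).ρ h)).trans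
      ((congrArg (LinearMap.trace k X.V a * ·) h1).trans ?_)
    rw [sweedlerPower_zero, AlgHom.commutes, Algebra.algebraMap_eq_smul_one, LinearMap.comp_smul,
      map_smul, smul_eq_mul, mul_comm]
    rfl
  | succ m ih =>
    have r := Coalgebra.Repr.arbitrary k h
    rw [rotation_succ, sweedlerPower_succ_repr m r]
    refine (trace_comp_tensorAction X.ρ (X.tpow m).ρ (rotation X m) a r).trans ?_
    have h1 : a ∘ₗ X.ρ (∑ i ∈ r.index, r.left i * sweedlerPower k m (r.right i)) =
        ∑ i ∈ r.index, (a ∘ₗ X.ρ (r.left i)) ∘ₗ X.ρ (sweedlerPower k m (r.right i)) := by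
      ext x
      simp
    rw [h1, map_sum]
    exact Finset.sum_congr rfl fun i _ => ih _ _

/-- The character of `X` on a Sweedler power as the trace of a cyclic rotation. -/
theorem trace_rotation_comp_action (X : HopfRep k H) (m : ℕ) (h : H) :
    LinearMap.trace k _ (rotation X m ∘ₗ (X.tensor (X.tpow m)).ρ h) =
      LinearMap.trace k X.V (X.ρ (sweedlerPower k (m + 1) h)) := by
  have r := Coalgebra.Repr.arbitrary k h
  have h1 : rotation X m ∘ₗ (X.tensor (X.tpow m)).ρ h = ∑ i ∈ r.index,
      rotation X m ∘ₗ TensorProduct.map (X.ρ (r.left i)) ((X.tpow m).ρ (r.right i)) := by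
    rw [tensorAction_eq_sum X.ρ (X.tpow m).ρ r]
    ext x w
    simp
  rw [h1, map_sum, sweedlerPower_succ_repr m r, map_sum, map_sum]
  refine Finset.sum_congr rfl fun i _ => ?_
  rw [trace_rotation_comp_map, map_mul]
  rfl

/-- For a canonical pivotal structure, `E_X^{(n)}` is the cyclic rotation of the tensor factors. -/
theorem EFun_apply {P : PivotalStructure k H} {X : HopfRep k H}
    (hj : (P.j X).toEquiv = Module.evalEquiv k X.V) (m : ℕ)
    (f : Hom (unit k H) (X.tensor (X.tpow m))) :
    (P.EFun X m f).1 (ULift.up 1) = rotation X m (f.1 (ULift.up 1)) := by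
  let M : Module.Dual k X.V ⊗[k] ((X.V ⊗[k] (X.tpow m).V) ⊗[k]
      Module.Dual k (Module.Dual k X.V)) →ₗ[k] X.V ⊗[k] (X.tpow m).V :=
    (X.snoc m).1 ∘ₗ (lunit.{u} k ((X.tpow m).V ⊗[k] X.V)).toLinearMap ∘ₗ
      TensorProduct.map (evMap.{u} k X.V)
        (TensorProduct.map LinearMap.id (P.j X).toEquiv.symm.toLinearMap) ∘ₗ
      (TensorProduct.assoc k (Module.Dual k X.V) X.V
        ((X.tpow m).V ⊗[k] Module.Dual k (Module.Dual k X.V))).symm.toLinearMap ∘ₗ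
      TensorProduct.map LinearMap.id
        (TensorProduct.assoc k X.V (X.tpow m).V (Module.Dual k (Module.Dual k X.V))).toLinearMap
  have h0 : (P.EFun X m f).1 (ULift.up 1) =
      M (TensorProduct.map LinearMap.id (TensorProduct.map f.1 LinearMap.id)
        (TensorProduct.map LinearMap.id
          (lunit.{u} k (Module.Dual k (Module.Dual k X.V))).symm.toLinearMap
            (coevaluation k (Module.Dual k X.V) 1))) := rfl
  have h1 : ∀ c : Module.Dual k (Module.Dual k X.V),
      (lunit.{u} k (Module.Dual k (Module.Dual k X.V))).symm c = ULift.up 1 ⊗ₜ c := fun c => by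
    rw [LinearEquiv.symm_apply_eq]
    simp [lunit]
  have hM : ∀ (b : Module.Dual k X.V) (c : Module.Dual k (Module.Dual k X.V)) (x : X.V)
      (w : (X.tpow m).V), M (b ⊗ₜ ((x ⊗ₜ w) ⊗ₜ c)) =
        (X.snoc m).1 (w ⊗ₜ (P.j X).toEquiv.symm (b x • c)) := by
    intro b c x w
    simp [M, lunit, evMap]
  let B := Module.Basis.ofVectorSpace k (Module.Dual k X.V)
  -- The coevaluation of X^* contracted with x gives evaluation at x, which the inverse of j_X sends
  -- back to x.
  have hB : ∀ x : X.V, ∑ i, B i x • B.coord i = Module.evalEquiv k X.V x := by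
    intro x
    ext φ
    have h2 := LinearMap.congr_fun (B.sum_repr φ) x
    rw [LinearMap.sum_apply] at h2
    simpa [-Module.Basis.sum_repr, mul_comm] using h2
  have key : ∀ t : X.V ⊗[k] (X.tpow m).V,
      ∑ i, M (B i ⊗ₜ (t ⊗ₜ B.coord i)) = rotation X m t := by
    intro t
    induction t with
    | zero => simp
    | add t t' ht ht' =>
      simp only [TensorProduct.add_tmul, TensorProduct.tmul_add, map_add, Finset.sum_add_distrib,
        ht, ht']
    | tmul x w =>
      simp only [hM]
      rw [← map_sum, ← TensorProduct.tmul_sum, ← map_sum, hB, ← hj, LinearEquiv.symm_apply_apply]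
      rfl
  rw [h0, coevaluation_apply_one, ← key]
  simp only [map_sum, TensorProduct.map_tmul, LinearMap.id_apply, LinearEquiv.coe_coe, h1]
  rfl

/-- The indicator as a value of the character on a Sweedler power of the integral. -/
theorem indicator_eq_trace {P : PivotalStructure k H} {X : HopfRep k H}
    (hj : (P.j X).toEquiv = Module.evalEquiv k X.V) {Λ : H} (hΛ : IsNormalizedIntegral k Λ)
    (m : ℕ) : P.indicator X (m + 1) =
      LinearMap.trace k X.V (X.ρ (sweedlerPower k (m + 1) Λ)) := by
  let Y := X.tensor (X.tpow m)
  -- The map ι embeds the Hom space as the invariants of Y, and r below is the action of Λ viewed as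
  -- a map onto them.
  let ι : Hom (unit k H) Y →ₗ[k] Y.V :=
    { toFun := fun f => f.1 (ULift.up 1)
      map_add' := fun f g => rfl
      map_smul' := fun c f => rfl }
  have hι : ∀ f g : Hom (unit k H) Y, ι f = ι g → f = g := by
    intro f g h
    refine Subtype.ext (LinearMap.ext fun c => ?_)
    have hc : c = c.down • (ULift.up 1 : ULift.{u} k) := by
      ext
      simp
    rw [hc, map_smul, map_smul]
    exact congrArg (c.down • ·) h
  let r : Y.V →ₗ[k] Hom (unit k H) Y :=
    { toFun := fun y => ⟨(LinearMap.toSpanSingleton k Y.V (Y.ρ Λ y)) ∘ₗ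
          (ULift.moduleEquiv (R := k) (M := k)).toLinearMap, fun h c => by
        have h1 : Y.ρ h (Y.ρ Λ y) = Coalgebra.counit (R := k) h • Y.ρ Λ y := by
          rw [← Module.End.mul_apply, ← map_mul, hΛ.mul_left, map_smul, LinearMap.smul_apply]
        simp [h1, smul_smul, mul_comm]⟩
      map_add' := fun y y' => hι _ _ (by simp [ι])
      map_smul' := fun c y => hι _ _ (by simp [ι]) }
  have hr : ∀ y, ι (r y) = Y.ρ Λ y := fun y => by simp [ι, r]
  have hinv : ∀ f, Y.ρ Λ (ι f) = ι f := by
    intro f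
    have h1 := f.2 Λ (ULift.up 1)
    rw [trivialAction_apply, hΛ.counit_eq, one_smul] at h1
    exact h1.symm
  -- E already takes invariant values, so composing the rotation with Λ changes nothing; cyclicity
  -- of the trace then moves the computation to all of Y.
  have hE : P.E X m = r ∘ₗ (rotation X m ∘ₗ ι) := by
    refine LinearMap.ext fun f => hι _ _ ?_
    have h1 : ι (P.E X m f) = rotation X m (ι f) := EFun_apply hj m f
    rw [LinearMap.comp_apply, hr, LinearMap.comp_apply, ← h1, hinv]
  have h2 : (rotation X m ∘ₗ ι) ∘ₗ r = rotation X m ∘ₗ Y.ρ Λ :=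
    LinearMap.ext fun y => congrArg (rotation X m) (hr y)
  change LinearMap.trace k _ (P.E X m) = _
  rw [hE, LinearMap.trace_comp_comm', h2]
  exact trace_rotation_comp_action X m Λ

end CyclicRotation

end
end HopfFS

/-! ### Equality of the indicators -/

theorem corollary5p16 (H : Type u) [Ring H] [HopfAlgebra ℂ H] [FiniteDimensional ℂ H]
    [IsSemisimpleRing H] :
    IsSemisimpleRing (HopfFS.HopfDual ℂ H) ∧
    (∃! P : HopfFS.PivotalStructure ℂ H, P.IsCanonical) ∧
    (∃! Q : HopfFS.PivotalStructure ℂ (HopfFS.HopfDual ℂ H), Q.IsCanonical) ∧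
    ∀ (P : HopfFS.PivotalStructure ℂ H) (Q : HopfFS.PivotalStructure ℂ (HopfFS.HopfDual ℂ H)),
      P.IsCanonical → Q.IsCanonical → ∀ n : ℕ, 1 ≤ n →
        Q.indicator (HopfFS.HopfRep.regular ℂ (HopfFS.HopfDual ℂ H)) n =
          P.indicator (HopfFS.HopfRep.regular ℂ H) n := by
  have hss := HopfFS.isSemisimpleRing_hopfDual H
  have hS := HopfFS.antipode_antipode_of_isSemisimpleRing (H := H)
  have hS' := HopfFS.antipode_antipode_of_isSemisimpleRing (H := HopfFS.HopfDual ℂ H)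
  refine ⟨hss, HopfFS.existsUnique_isCanonical hS, HopfFS.existsUnique_isCanonical hS', ?_⟩
  intro P Q hP hQ n hn
  obtain ⟨m, rfl⟩ : ∃ m, n = m + 1 := ⟨n - 1, by omega⟩
  obtain ⟨Λ, hΛ⟩ := HopfFS.exists_isNormalizedIntegral ℂ H
  rw [HopfFS.indicator_eq_trace (hQ.toEquiv_eq hS' _) (HopfFS.isNormalizedIntegral_dual hΛ),
    HopfFS.indicator_eq_trace (hP.toEquiv_eq hS _) hΛ]
  -- The factor λ(1) in the regular character of H^* cancels the normalization λ(1)⁻¹ of its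
  -- integral.
  have h1 := HopfFS.toForm_regularCharacter_dual hΛ
    (HopfFS.sweedlerPower ℂ (m + 1) ((HopfFS.toForm ℂ H (HopfFS.dualIntegral hΛ) 1)⁻¹ •
      HopfFS.dualIntegral hΛ))
  have h2 : HopfFS.toForm ℂ H (HopfFS.regularCharacter ℂ H) (HopfFS.sweedlerPower ℂ (m + 1) Λ) =
      HopfFS.toForm ℂ H (HopfFS.dualIntegral hΛ) (HopfFS.sweedlerPower ℂ (m + 1) Λ) := by
    rw [HopfFS.regularCharacter_eq_dualIntegral hΛ]
  refine h1.trans (Eq.trans ?_ h2.symm)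
  rw [HopfFS.toForm_sweedlerPower, map_smul, LinearMap.smul_apply, smul_eq_mul, ← mul_assoc,
    mul_inv_cancel₀ (HopfFS.toForm_dualIntegral_one_ne_zero hΛ), one_mul]
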